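/- Let $n\ge 1$ and let $G=\mathrm{Sp}_{2n}(\mathbb C)$ be the simply connected simple algebraic group of type $C_n$, realized on the vector representation $V(\Lambda_1)$ with basis $v_1,\dots,v_n,v_{\bar n},\dots,v_{\bar 1}$ and Chevalley generators given by $f_iv_i=v_{i+1}$, $f_iv_{\overline{i+1}}=v_{\bar i}$, $e_iv_{i+1}=v_i$, $e_iv_{\bar i}=v_{\overline{i+1}}$ $(1\le i<n)$, $f_nv_n=v_{\bar n}$, $e_nv_{\bar n}=v_n$, all other actions on basis vectors being zero. Let $T$ be the diagonal maximal torus, $U^{\pm}$ the upper and lower unitriangular subgroups of $G$ (in the above order of the basis), $\Lambda_1,\dots,\Lambda_n$ the fundamental weights, so that $v_j$ has weight $\Lambda_j-\Lambda_{j-1}$ and $v_{\bar j}$ has weight $\Lambda_{j-1}-\Lambda_j$ with $\Lambda_0=0$, and $\alpha_i^\vee:\mathbb C^\times\to T$ the simple coroots. Put $x_i(t)=\exp(te_i)$, $y_i(t)=\exp(tf_i)$, $\bar s_i=x_i(-1)y_i(1)x_i(-1)$, and $\bar w=\bar s_{i_1}\cdots\bar s_{i_l}$ for a reduced word $(i_1,\dots,i_l)$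 of a Weyl group element $w$. The principal minor $\Delta_{\Lambda_k}$ is the regular function on $G$ with $\Delta_{\Lambda_k}(u^-tu^+)=\Lambda_k(t)$ for $u^\pm\in U^\pm$, $t\in T$, and the generalized minors are $\Delta_{u\Lambda_k,v\Lambda_k}(g)=\Delta_{\Lambda_k}(\bar u^{-1}g\,\bar v)$. Let $w_0$ be the longest Weyl group element, with the reduced word $\mathbf i_0=(1\,2\cdots n)^n$. For $c=(c^{(1)}_1,c^{(1)}_2,\dots,c^{(1)}_n,c^{(2)}_1,\dots,c^{(n)}_n)\in(\mathbb C^\times)^{n^2}$ set $$\Theta^-_{\mathbf i_0}(c)=\prod_{j=1}^{n}\Big(\mathbf y_1(c^{(j)}_1)\,\mathbf y_2(c^{(j)}_2)\cdots\mathbf y_n(c^{(j)}_n)\Big),\qquad \mathbf y_i(a)=y_i(a)\,\alpha_i^\vee(a^{-1}),$$ the factors of the outer product being taken in the order $j=1,2,\dots,n$ from left to right. Then for $k=1,\dots,n-1$ $$\Delta_{w_0\Lambda_k,s_k\Lambda_k}(\Theta^-_{\mathbf i_0}(c))=c^{(k)}_1+\sum_{j=2}^{n}\frac{c^{(k)}_j}{c^{(k+1)}_{j-1}}+\sum_{j=1}^{n-k}\frac{c^{(k+j)}_{n-j}}{c^{(k+j)}_{n-j+1}},$$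 and for $k=n$ $$\Delta_{w_0\Lambda_n,s_n\Lambda_n}(\Theta^-_{\mathbf i_0}(c))=c^{(n)}_n.$$ -/

import Mathlib

namespace TypeC

open Matrix

/-- The index set of the basis of the vector representation `V(Λ₁)` of type `C_n`:
`Sum.inl a` is the index of `v_{a+1}` and `Sum.inr a` that of `v_{\overline{a+1}}`. -/
abbrev Idx (n : ℕ) : Type := Fin n ⊕ Fin n

/-- The Chevalley generator `e_i` (`1 ≤ i ≤ n`) on `V(Λ₁)`:
for `i < n`, `e_i v_{i+1} = v_i` and `e_i v_{\bar i} = v_{\overline{i+1}}`;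
`e_n v_{\bar n} = v_n`; all other basis vectors are sent to `0`. -/
def e (n i : ℕ) : Matrix (Idx n) (Idx n) ℂ :=
  Matrix.fromBlocks
    (Matrix.of fun a b => if a.val + 1 = i ∧ b.val + 1 = i + 1 then 1 else 0)
    (Matrix.of fun a b => if a.val + 1 = i ∧ b.val + 1 = i ∧ i = n then 1 else 0)
    0
    (Matrix.of fun a b => if a.val + 1 = i + 1 ∧ b.val + 1 = i then 1 else 0)

/-- The Chevalley generator `f_i` (`1 ≤ i ≤ n`) on `V(Λ₁)`:
for `i < n`, `f_i v_i = v_{i+1}` and `f_i v_{\overline{i+1}} = v_{\bar i}`;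
`f_n v_n = v_{\bar n}`; all other basis vectors are sent to `0`. -/
def f (n i : ℕ) : Matrix (Idx n) (Idx n) ℂ :=
  Matrix.fromBlocks
    (Matrix.of fun a b => if a.val + 1 = i + 1 ∧ b.val + 1 = i then 1 else 0)
    0
    (Matrix.of fun a b => if a.val + 1 = i ∧ b.val + 1 = i ∧ i = n then 1 else 0)
    (Matrix.of fun a b => if a.val + 1 = i ∧ b.val + 1 = i + 1 then 1 else 0)

/-- The eigenvalue of the simple coroot `h_i` on a basis vector of `V(Λ₁)`, that is,
`⟨h_i, wt v_j⟩` with `wt v_j = Λ_j - Λ_{j-1}` and `wt v_{\bar j} = Λ_{j-1} - Λ_j`. -/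
def hWeight (n i : ℕ) : Idx n → ℤ
  | Sum.inl a => (if a.val + 1 = i then 1 else 0) - (if a.val = i then 1 else 0)
  | Sum.inr a => (if a.val = i then 1 else 0) - (if a.val + 1 = i then 1 else 0)

/-- The signs `⟨v_j, v_{\bar j}⟩ = (-1)^j` of the invariant symplectic form. -/
def formSign (n : ℕ) : Matrix (Fin n) (Fin n) ℂ :=
  Matrix.diagonal fun a => (-1) ^ (a.val + 1)

/-- The Gram matrix of the non-degenerate alternating form on `V(Λ₁)` that is invariant under
all `e_i` and `f_i`: `⟨v_j, v_{\bar j}⟩ = (-1)^j = -⟨v_{\bar j}, v_j⟩`, all others `0`. -/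
def form (n : ℕ) : Matrix (Idx n) (Idx n) ℂ :=
  Matrix.fromBlocks 0 (formSign n) (-formSign n) 0

/-- The simply connected group `G = Sp_{2n}(ℂ)` of type `C_n`, acting on `V(Λ₁)`. -/
def G (n : ℕ) : Subgroup (GL (Idx n) ℂ) where
  carrier := {g | (g.val)ᵀ * form n * g.val = form n}
  one_mem' := by simp
  mul_mem' := by
    intro a b ha hb
    simp only [Set.mem_ofPred_eq, Units.val_mul, Matrix.transpose_mul] at *
    calc (b.val)ᵀ * (a.val)ᵀ * form n * (a.val * b.val)
        = (b.val)ᵀ * ((a.val)ᵀ * form n * a.val) * b.val := by simp only [Matrix.mul_assoc]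
      _ = form n := by rw [ha, hb]
  inv_mem' := by
    intro a ha
    simp only [Set.mem_ofPred_eq] at *
    have h1 : a.val * (a⁻¹).val = 1 := a.mul_inv
    have h2 : ((a⁻¹).val)ᵀ * (a.val)ᵀ = 1 := by
      rw [← Matrix.transpose_mul, h1, Matrix.transpose_one]
    calc ((a⁻¹).val)ᵀ * form n * (a⁻¹).val
        = ((a⁻¹).val)ᵀ * ((a.val)ᵀ * form n * a.val) * (a⁻¹).val := by rw [ha]
      _ = (((a⁻¹).val)ᵀ * (a.val)ᵀ) * form n * (a.val * (a⁻¹).val) := by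
          simp only [Matrix.mul_assoc]
      _ = form n := by rw [h1, h2]; simp

/-- The matrix of an element of `G`. -/
def mat {n : ℕ} (g : G n) : Matrix (Idx n) (Idx n) ℂ := g.val.val

theorem e_sq (n i : ℕ) : e n i * e n i = 0 := by
  ext a b
  rw [Matrix.mul_apply, Matrix.zero_apply]
  refine Finset.sum_eq_zero fun x _ => ?_
  rcases a with a | a <;> rcases b with b | b <;> rcases x with x | x <;>
    simp [e, Matrix.of_apply] <;> omega

theorem f_eq (n i : ℕ) : f n i = (e n i)ᵀ := by
  ext a b
  rcases a with a | a <;> rcases b with b | b <;> simp only [e, f, Matrix.transpose_apply,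
    Matrix.fromBlocks_apply₁₁, Matrix.fromBlocks_apply₁₂, Matrix.fromBlocks_apply₂₁,
    Matrix.fromBlocks_apply₂₂, Matrix.of_apply, Matrix.zero_apply]
  all_goals exact if_congr (by omega) rfl rfl

theorem f_sq (n i : ℕ) : f n i * f n i = 0 := by
  rw [f_eq, ← Matrix.transpose_mul, e_sq, Matrix.transpose_zero]

theorem exp_smul_eq {n : ℕ} {N : Matrix (Idx n) (Idx n) ℂ} (hN : N * N = 0) (t : ℂ) :
    IsNilpotent.exp (t • N) = 1 + t • N := by
  have h : (t • N) ^ 2 = 0 := by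
    rw [pow_two, Matrix.smul_mul, Matrix.mul_smul, hN]; simp
  rw [IsNilpotent.exp_eq_sum h]
  simp [Finset.sum_range_succ]

theorem e_form (n i : ℕ) : (e n i)ᵀ * form n = -(form n * e n i) := by
  ext a b
  rcases a with a | a <;> rcases b with b | b <;>
    simp only [e, form, formSign, Matrix.fromBlocks_multiply, Matrix.fromBlocks_transpose,
      Matrix.mul_diagonal, Matrix.diagonal_mul, Matrix.neg_apply, Matrix.fromBlocks_apply₁₁,
      Matrix.fromBlocks_apply₁₂, Matrix.fromBlocks_apply₂₁, Matrix.fromBlocks_apply₂₂,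
      Matrix.add_apply, Matrix.mul_zero, Matrix.zero_mul, Matrix.zero_apply, Matrix.mul_neg,
      Matrix.neg_mul, Matrix.transpose_apply, Matrix.of_apply, Matrix.transpose_zero]
  all_goals first
    | simp; done
    | split_ifs <;> first
        | omega
        | simp; done
        | (rw [show b.val = a.val by omega]; ring)
        | (rw [show b.val = a.val + 1 by omega]; ring)
        | (rw [show a.val = b.val + 1 by omega]; ring)

theorem f_form (n i : ℕ) : (f n i)ᵀ * form n = -(form n * f n i) := by
  ext a b
  rcases a with a | a <;> rcases b with b | b <;>
    simp only [f, form, formSign, Matrix.fromBlocks_multiply, Matrix.fromBlocks_transpose,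
      Matrix.mul_diagonal, Matrix.diagonal_mul, Matrix.neg_apply, Matrix.fromBlocks_apply₁₁,
      Matrix.fromBlocks_apply₁₂, Matrix.fromBlocks_apply₂₁, Matrix.fromBlocks_apply₂₂,
      Matrix.add_apply, Matrix.mul_zero, Matrix.zero_mul, Matrix.zero_apply, Matrix.mul_neg,
      Matrix.neg_mul, Matrix.transpose_apply, Matrix.of_apply, Matrix.transpose_zero]
  all_goals first
    | simp; done
    | split_ifs <;> first
        | omega
        | simp; done
        | (rw [show b.val = a.val by omega]; ring)
        | (rw [show b.val = a.val + 1 by omega]; ring)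
        | (rw [show a.val = b.val + 1 by omega]; ring)

/-- `exp(tN)` is symplectic if `N² = 0` and `N` is infinitesimally symplectic. -/
theorem exp_mem {n : ℕ} {N : Matrix (Idx n) (Idx n) ℂ} (hN : N * N = 0)
    (hf : Nᵀ * form n = -(form n * N)) (t : ℂ) :
    (IsNilpotent.exp (t • N))ᵀ * form n * IsNilpotent.exp (t • N) = form n := by
  rw [exp_smul_eq hN]
  have h : Nᵀ * form n * N = 0 := by
    rw [hf, Matrix.neg_mul, Matrix.mul_assoc, hN]; simp
  simp only [Matrix.transpose_add, Matrix.transpose_one, Matrix.transpose_smul, Matrix.add_mul,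
    Matrix.mul_add, Matrix.one_mul, Matrix.mul_one, Matrix.smul_mul, Matrix.mul_smul, h]
  rw [hf]
  simp

theorem isNilpotent_smul {n : ℕ} {N : Matrix (Idx n) (Idx n) ℂ} (hN : N * N = 0) (t : ℂ) :
    IsNilpotent (t • N) :=
  ⟨2, by rw [pow_two, Matrix.smul_mul, Matrix.mul_smul, hN]; simp⟩

/-- The one-parameter subgroup `exp(tN)` of `G`. -/
noncomputable def oneParam {n : ℕ} (N : Matrix (Idx n) (Idx n) ℂ) (hN : N * N = 0)
    (hf : Nᵀ * form n = -(form n * N)) (t : ℂ) : G n :=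
  ⟨⟨IsNilpotent.exp (t • N), IsNilpotent.exp (-(t • N)),
    IsNilpotent.exp_mul_exp_neg_self (isNilpotent_smul hN t),
    IsNilpotent.exp_neg_mul_exp_self (isNilpotent_smul hN t)⟩, exp_mem hN hf t⟩

/-- `x_i(t) = exp(t e_i)`. -/
noncomputable def x (n i : ℕ) (t : ℂ) : G n := oneParam (e n i) (e_sq n i) (e_form n i) t

/-- `y_i(t) = exp(t f_i)`. -/
noncomputable def y (n i : ℕ) (t : ℂ) : G n := oneParam (f n i) (f_sq n i) (f_form n i) t

/-- `α_i^∨(c) = c^{h_i}`, the image of `diag(c, c⁻¹)` under the homomorphism `SL₂ → G`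
attached to `i`. -/
noncomputable def coroot (n i : ℕ) (c : ℂˣ) : G n :=
  ⟨⟨Matrix.diagonal fun a => ((c ^ hWeight n i a : ℂˣ) : ℂ),
    Matrix.diagonal fun a => ((c ^ (-hWeight n i a) : ℂˣ) : ℂ),
    by rw [Matrix.diagonal_mul_diagonal, ← Matrix.diagonal_one]
       congr 1; funext a; rw [← Units.val_mul, ← _root_.zpow_add]; simp,
    by rw [Matrix.diagonal_mul_diagonal, ← Matrix.diagonal_one]
       congr 1; funext a; rw [← Units.val_mul, ← _root_.zpow_add]; simp⟩, by
    change (Matrix.diagonal _)ᵀ * form n * Matrix.diagonal _ = form n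
    ext a b
    rw [Matrix.diagonal_transpose, Matrix.mul_diagonal, Matrix.diagonal_mul]
    by_cases h : hWeight n i a + hWeight n i b = 0
    · have h' : ((c ^ hWeight n i a : ℂˣ) : ℂ) * ((c ^ hWeight n i b : ℂˣ) : ℂ) = 1 := by
        rw [← Units.val_mul, ← _root_.zpow_add, h]; simp
      calc _ = form n a b * (((c ^ hWeight n i a : ℂˣ) : ℂ) * ((c ^ hWeight n i b : ℂˣ) : ℂ)) := by
              ring
        _ = _ := by rw [h', mul_one]
    · have h' : form n a b = 0 := by
        rcases a with a | a <;> rcases b with b | b <;> simp [form, formSign]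
        all_goals
          by_contra hab
          have hab : a = b := by
            by_contra h2
            exact hab (Matrix.diagonal_apply_ne _ h2)
          subst hab
          exact h (by simp [hWeight])
      rw [h']; simp⟩

/-- `\bar s_i = x_i(-1) y_i(1) x_i(-1)`, the representative in `G` of the simple reflection. -/
noncomputable def sBar (n i : ℕ) : G n := x n i (-1) * y n i 1 * x n i (-1)

/-- The representative `\bar w = \bar s_{i_1} ⋯ \bar s_{i_l}` in `G` of the Weyl group element
`w = s_{i_1} ⋯ s_{i_l}` given by a reduced word `i_1, …, i_l`. -/
noncomputable def wBar (n : ℕ) (w : List ℕ) : G n := (w.map (sBar n)).prod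

/-- The reduced word `i₀ = (1 2 ⋯ n)^n` of the longest Weyl group element `w₀` of type `C_n`. -/
def longWord (n : ℕ) : List ℕ := (List.replicate n (List.range' 1 n)).flatten

/-- `𝐲_i(c) = y_i(c) α_i^∨(c⁻¹)`. -/
noncomputable def yBold (n i : ℕ) (c : ℂˣ) : G n := y n i c * coroot n i c⁻¹

/-- `Θ^-_{𝐢}(c_1, …, c_N) = 𝐲_{i_1}(c_1) ⋯ 𝐲_{i_N}(c_N)` for a word `𝐢 = (i_1, …, i_N)`. -/
noncomputable def Theta (n : ℕ) (w : List ℕ) (c : List ℂˣ) : G n :=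
  (List.zipWith (yBold n) w c).prod

/-- The array `c_i^{(j)}`, `1 ≤ i, j ≤ n` (written `c i j`), as the list
`(c_1^{(1)}, c_2^{(1)}, …, c_n^{(1)}, c_1^{(2)}, …, c_n^{(n)})`. -/
def params (n : ℕ) (c : ℕ → ℕ → ℂˣ) : List ℂˣ :=
  (List.range' 1 n).flatMap fun j => (List.range' 1 n).map fun i => c i j

/-- The position of a basis vector in the order
`v_1, v_2, …, v_n, v_{\bar n}, …, v_{\bar 2}, v_{\bar 1}`. -/
def pos (n : ℕ) : Idx n → ℕ
  | Sum.inl a => a.val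
  | Sum.inr a => 2 * n - 1 - a.val

/-- The maximal unipotent subgroup `U = U⁺`: the upper unitriangular elements of `G`
with respect to the order of the basis given by `pos`. -/
def IsUPlus {n : ℕ} (g : G n) : Prop :=
  (∀ a, mat g a a = 1) ∧ ∀ a b, pos n b < pos n a → mat g a b = 0

/-- The opposite maximal unipotent subgroup `U⁻`: the lower unitriangular elements of `G`. -/
def IsUMinus {n : ℕ} (g : G n) : Prop :=
  (∀ a, mat g a a = 1) ∧ ∀ a b, pos n a < pos n b → mat g a b = 0

/-- The maximal torus `T`: the diagonal elements of `G`. -/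
def IsTorus {n : ℕ} (g : G n) : Prop := (mat g).IsDiag

/-- The value at `t ∈ T` of the fundamental weight `Λ_k = wt v_1 + ⋯ + wt v_k`. -/
def fundWeight (n k : ℕ) (t : G n) : ℂ :=
  ∏ a : {a : Fin n // a.val + 1 ≤ k}, mat t (Sum.inl a.val) (Sum.inl a.val)

/-- Regular functions on the closed subgroup `G` of `SL_{2n}(ℂ)`: the restrictions of
polynomials in the matrix entries. -/
def IsRegular {n : ℕ} (F : G n → ℂ) : Prop :=
  ∃ P : MvPolynomial (Idx n × Idx n) ℂ, ∀ g : G n,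
    F g = MvPolynomial.eval (fun ab => mat g ab.1 ab.2) P

/-- `F` is the principal minor `Δ_μ` of the dominant weight `μ`: the regular function on `G`
with `Δ_μ(u⁻ t u⁺) = μ(t)` for `u^± ∈ U^±` and `t ∈ T`. -/
def IsPrincipalMinor {n : ℕ} (μ : G n → ℂ) (F : G n → ℂ) : Prop :=
  IsRegular F ∧ ∀ u t v : G n, IsUMinus u → IsTorus t → IsUPlus v → F (u * t * v) = μ t

theorem exists_principalMinor (n k : ℕ) :
    ∃ F : G n → ℂ, IsPrincipalMinor (fundWeight n k) F := by
  let r : {a : Fin n // a.val + 1 ≤ k} → Idx n := fun a => Sum.inl a.val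
  have hr : Function.Injective r := fun a b h => Subtype.ext (Sum.inl_injective h)
  have hout : ∀ (a : {a : Fin n // a.val + 1 ≤ k}) (b : Idx n), b ∉ Set.range r →
      pos n (r a) < pos n b := by
    rintro ⟨a, ha⟩ (b | b) hb
    · have hb' : ¬ b.val + 1 ≤ k := fun h => hb ⟨⟨b, h⟩, rfl⟩
      simp only [r, pos]; omega
    · simp only [r, pos]; omega
  refine ⟨fun g => ((mat g).submatrix r r).det,
    ⟨(Matrix.of fun a b => MvPolynomial.X (r a, r b)).det, fun g => ?_⟩, ?_⟩
  · rw [RingHom.map_det]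
    refine congrArg Matrix.det ?_
    ext a b
    simp
  · intro u t v hu ht hv
    have h1 : (mat (u * t * v)).submatrix r r =
        (mat u).submatrix r r * (mat t).submatrix r r * (mat v).submatrix r r := by
      change (mat u * mat t * mat v).submatrix r r = _
      ext a b
      rw [Matrix.mul_assoc, Matrix.mul_assoc, Matrix.submatrix_apply, Matrix.mul_apply,
        Matrix.mul_apply]
      symm
      refine Fintype.sum_of_injective r hr _ _ (fun x hx => ?_) (fun x => ?_)
      · rw [hu.2 _ _ (hout a x hx), zero_mul]
      · rw [Matrix.submatrix_apply, Matrix.mul_apply, Matrix.mul_apply]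
        congr 1
        refine Fintype.sum_of_injective r hr _ _ (fun z hz => ?_) (fun z => rfl)
        rw [hv.2 _ _ (hout b z hz), mul_zero]
    have hmono : ∀ a b : {a : Fin n // a.val + 1 ≤ k}, a < b → pos n (r a) < pos n (r b) :=
      fun a b h => h
    change ((mat (u * t * v)).submatrix r r).det = _
    have du : ((mat u).submatrix r r).det = 1 := by
      rw [← Matrix.det_transpose, Matrix.det_of_isUpperTriangular
        (M := ((mat u).submatrix r r)ᵀ) (fun a b h => hu.2 _ _ (hmono _ _ h))]
      simp [hu.1]
    have dv : ((mat v).submatrix r r).det = 1 := by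
      rw [Matrix.det_of_isUpperTriangular (M := (mat v).submatrix r r)
        (fun a b h => hv.2 _ _ (hmono _ _ h))]
      simp [hv.1]
    have dt : ((mat t).submatrix r r).det = fundWeight n k t := by
      rw [Matrix.det_of_isUpperTriangular (M := (mat t).submatrix r r)
        (fun a b h => ht (fun hab => absurd (hr hab) (ne_of_gt h)))]
      rfl
    rw [h1, Matrix.det_mul, Matrix.det_mul, du, dv, dt]
    simp

/-- The principal minor `Δ_{Λ_k}` of the fundamental weight `Λ_k`. (It is unique, because
`U⁻ T U⁺` is dense in `G`.) -/
noncomputable def principalMinor (n k : ℕ) : G n → ℂ := (exists_principalMinor n k).choose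

/-- The generalized minor `Δ_{uΛ_k, vΛ_k}(g) = Δ_{Λ_k}(\bar u⁻¹ g \bar v)`, where the Weyl group
elements `u` and `v` are given by reduced words. -/
noncomputable def genMinor (n k : ℕ) (u v : List ℕ) (g : G n) : ℂ :=
  principalMinor n k ((wBar n u)⁻¹ * g * wBar n v)

end TypeC

namespace TypeC

open Matrix

/-! Write `g = \bar w₀⁻¹ Θ(c)`. The wanted minor is `Δ_{Λ_k}(g \bar s_k)`, and the point is that `g`
lies in `U⁻ U⁺`. If `g = u v`, the minor is the coordinate of `v` at the simple root `α_k`: the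
entry of `v` at `(v_k, v_{k+1})` for `k < n`, and at `(v_n, v_{\bar n})` for `k = n`. Indeed, if `a`
is this coordinate, then `v = x_k(a) v'` where `v'` has coordinate zero, so `\bar s_k` conjugates
`v'` into `U⁺`. The value then follows from the Gauss decomposition of `x_k(a) \bar s_k` in the
`SL₂` of `α_k` (`x_mul_sBar`) for `a ≠ 0`, and by continuity for `a = 0`. Only the defining property
of the principal minor is used, never a determinant.

It remains to find the first `n` rows of `v`; by `exists_uMinus_mul_uPlus` a factorization of the
first `n` rows of `g` suffices, since the symplectic form fixes the rest. Up to sign, row `v_k` of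
`g` is row `v_{\bar k}` of `Θ`. In one block `𝐲_1(d_1) ⋯ 𝐲_n(d_n)`, row `v_{\bar k}` is a multiple
of row `v_{\bar 1}` minus a combination of the coordinate vectors of `v_{\bar 1}, …,
v_{\overline{k-1}}`. Iterating over the blocks writes the rows of `g` as a lower unitriangular
combination of the vectors `uPlusRow`: row `v_{\bar 1}` of block `j`, multiplied by all later blocks
(`coordVBar_vecMul_blockProd_sub_mem`).

Row `v_{\bar 1}` of a block has its only unbarred coordinate at `v_n`, equal to `1`. Each later
block moves the leading `1` one place to the left, so block `j` produces a row with leading `1` at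
`v_j`. The coordinate after it gains one ratio per block; the first later block also contributes the
sum over `c^{(k)}_j / c^{(k+1)}_{j-1}`. This is the formula (`uPlusRow_eq`). -/

/-! ### Row vectors and the right action of the generators. -/

/-- The row vector on `V(Λ₁)` with coordinates `P` on the `v_j` and `Q` on the `v_{\bar j}`,
both numbered from zero. -/
def rowVec (n : ℕ) (P Q : ℕ → ℂ) : Idx n → ℂ :=
  Sum.elim (fun a => P a.val) (fun a => Q a.val)

@[simp] theorem rowVec_inl (n : ℕ) (P Q : ℕ → ℂ) (a : Fin n) :
    rowVec n P Q (Sum.inl a) = P a.val := rfl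

@[simp] theorem rowVec_inr (n : ℕ) (P Q : ℕ → ℂ) (a : Fin n) :
    rowVec n P Q (Sum.inr a) = Q a.val := rfl

theorem exists_rowVec {n : ℕ} (ξ : Idx n → ℂ) : ∃ P Q, ξ = rowVec n P Q := by
  refine ⟨fun b => if h : b < n then ξ (Sum.inl ⟨b, h⟩) else 0,
    fun b => if h : b < n then ξ (Sum.inr ⟨b, h⟩) else 0, ?_⟩
  funext a
  rcases a with a | a <;> simp

/-- Values of the sequences at indices `≥ n` are irrelevant, so boundary cases such as a shifted
index equal to `n` need no separate formula. -/
theorem rowVec_congr {n : ℕ} {P Q P' Q' : ℕ → ℂ} (hP : ∀ b < n, P b = P' b)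
    (hQ : ∀ b < n, Q b = Q' b) : rowVec n P Q = rowVec n P' Q' := by
  funext a
  rcases a with a | a
  · exact hP _ a.isLt
  · exact hQ _ a.isLt

theorem rowVec_add (n : ℕ) (P Q P' Q' : ℕ → ℂ) :
    rowVec n P Q + rowVec n P' Q' = rowVec n (P + P') (Q + Q') := by
  funext a
  rcases a with a | a <;> simp

theorem rowVec_smul (n : ℕ) (t : ℂ) (P Q : ℕ → ℂ) :
    t • rowVec n P Q = rowVec n (t • P) (t • Q) := by
  funext a
  rcases a with a | a <;> simp

theorem sum_ite_val {n : ℕ} (g : ℕ → ℂ) (m : ℕ) :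
    ∑ a : Fin n, (if a.val = m then g a.val else 0) = if m < n then g m else 0 := by
  by_cases h : m < n
  · rw [if_pos h, Finset.sum_eq_single_of_mem (⟨m, h⟩ : Fin n) (Finset.mem_univ _)]
    · simp
    · intro b _ hb
      exact if_neg fun hb' => hb (Fin.ext hb')
  · rw [if_neg h]
    exact Finset.sum_eq_zero fun a _ => if_neg (by omega)

theorem rowVec_vecMul_e {n j : ℕ} (hj : j + 1 < n) (P Q : ℕ → ℂ) :
    rowVec n P Q ᵥ* e n (j + 1) =
      rowVec n (fun b => if b = j + 1 then P j else 0) (fun b => if b = j then Q (j + 1) else 0) := by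
  funext a
  rcases a with a | a <;> simp only [vecMul, dotProduct, Fintype.sum_sum_type, rowVec_inl,
    rowVec_inr, e, fromBlocks_apply₁₁, fromBlocks_apply₁₂, fromBlocks_apply₂₁, fromBlocks_apply₂₂,
    of_apply, Matrix.zero_apply, mul_zero, Finset.sum_const_zero, add_zero, mul_ite, mul_one]
  · by_cases h : a.val = j + 1
    · simpa [h, show j < n by omega] using sum_ite_val (n := n) P j
    · simp [h]
  · by_cases h : a.val = j
    · simpa [h, show j + 1 ≠ n by omega, hj] using sum_ite_val (n := n) Q (j + 1)
    · simp [h]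

theorem rowVec_vecMul_e_last (m : ℕ) (P Q : ℕ → ℂ) :
    rowVec (m + 1) P Q ᵥ* e (m + 1) (m + 1) =
      rowVec (m + 1) 0 (fun b => if b = m then P m else 0) := by
  funext a
  rcases a with a | a <;> simp only [vecMul, dotProduct, Fintype.sum_sum_type, rowVec_inl,
    rowVec_inr, e, fromBlocks_apply₁₁, fromBlocks_apply₁₂, fromBlocks_apply₂₁, fromBlocks_apply₂₂,
    of_apply, Matrix.zero_apply, mul_zero, Finset.sum_const_zero, add_zero, mul_ite, mul_one]
  · simp [show a.val ≠ m + 1 by omega]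
  · have h2 : ∀ x : Fin (m + 1), x.val ≠ m + 1 := fun x => by omega
    by_cases h : a.val = m
    · simpa [h, h2] using sum_ite_val (n := m + 1) P m
    · simp [h]

theorem rowVec_vecMul_f {n j : ℕ} (hj : j + 1 < n) (P Q : ℕ → ℂ) :
    rowVec n P Q ᵥ* f n (j + 1) =
      rowVec n (fun b => if b = j then P (j + 1) else 0) (fun b => if b = j + 1 then Q j else 0) := by
  funext a
  rcases a with a | a <;> simp only [vecMul, dotProduct, Fintype.sum_sum_type, rowVec_inl,
    rowVec_inr, f, fromBlocks_apply₁₁, fromBlocks_apply₁₂, fromBlocks_apply₂₁, fromBlocks_apply₂₂,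
    of_apply, Matrix.zero_apply, mul_zero, Finset.sum_const_zero, zero_add, mul_ite, mul_one]
  · by_cases h : a.val = j
    · simpa [h, show j + 1 ≠ n by omega, hj] using sum_ite_val (n := n) P (j + 1)
    · simp [h]
  · by_cases h : a.val = j + 1
    · simpa [h, show j < n by omega] using sum_ite_val (n := n) Q j
    · simp [h]

theorem rowVec_vecMul_f_last (m : ℕ) (P Q : ℕ → ℂ) :
    rowVec (m + 1) P Q ᵥ* f (m + 1) (m + 1) =
      rowVec (m + 1) (fun b => if b = m then Q m else 0) 0 := by
  funext a
  rcases a with a | a <;> simp only [vecMul, dotProduct, Fintype.sum_sum_type, rowVec_inl,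
    rowVec_inr, f, fromBlocks_apply₁₁, fromBlocks_apply₁₂, fromBlocks_apply₂₁, fromBlocks_apply₂₂,
    of_apply, Matrix.zero_apply, mul_zero, Finset.sum_const_zero, zero_add, mul_ite, mul_one]
  · have h2 : ∀ x : Fin (m + 1), x.val ≠ m + 1 := fun x => by omega
    by_cases h : a.val = m
    · simpa [h, h2] using sum_ite_val (n := m + 1) Q m
    · simp [h]
  · simp [show a.val ≠ m + 1 by omega]

theorem mat_mul {n : ℕ} (g h : G n) : mat (g * h) = mat g * mat h := rfl

theorem mat_one {n : ℕ} : mat (1 : G n) = 1 := rfl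

theorem mat_injective {n : ℕ} : Function.Injective (mat : G n → Matrix (Idx n) (Idx n) ℂ) :=
  fun _ _ h => Subtype.ext (Units.ext h)

theorem mat_mul_mat_inv {n : ℕ} (g : G n) : mat g * mat g⁻¹ = 1 := by
  rw [← mat_mul, mul_inv_cancel, mat_one]

theorem mat_x (n i : ℕ) (t : ℂ) : mat (x n i t) = 1 + t • e n i := exp_smul_eq (e_sq n i) t

theorem mat_y (n i : ℕ) (t : ℂ) : mat (y n i t) = 1 + t • f n i := exp_smul_eq (f_sq n i) t

theorem mat_coroot (n i : ℕ) (c : ℂˣ) :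
    mat (coroot n i c) = Matrix.diagonal fun a => ((c ^ hWeight n i a : ℂˣ) : ℂ) := rfl

theorem eq_of_forall_rowVec {n : ℕ} {g h : G n}
    (H : ∀ P Q, rowVec n P Q ᵥ* mat g = rowVec n P Q ᵥ* mat h) : g = h := by
  refine mat_injective (Matrix.ext fun a b => ?_)
  obtain ⟨P, Q, hPQ⟩ := exists_rowVec (Pi.single a 1 : Idx n → ℂ)
  have := congrFun (H P Q) b
  rw [← hPQ] at this
  simpa using this

theorem rowVec_vecMul_x {n j : ℕ} (hj : j + 1 < n) (t : ℂ) (P Q : ℕ → ℂ) :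
    rowVec n P Q ᵥ* mat (x n (j + 1) t) =
      rowVec n (fun b => if b = j + 1 then P (j + 1) + t * P j else P b)
        (fun b => if b = j then Q j + t * Q (j + 1) else Q b) := by
  rw [mat_x, vecMul_add, vecMul_one, vecMul_smul, rowVec_vecMul_e hj, rowVec_smul, rowVec_add]
  refine rowVec_congr (fun b _ => ?_) (fun b _ => ?_) <;>
    simp only [Pi.add_apply, Pi.smul_apply, smul_eq_mul] <;> split_ifs with h <;> simp [h]

theorem rowVec_vecMul_x_last (m : ℕ) (t : ℂ) (P Q : ℕ → ℂ) :
    rowVec (m + 1) P Q ᵥ* mat (x (m + 1) (m + 1) t) =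
      rowVec (m + 1) P (fun b => if b = m then Q m + t * P m else Q b) := by
  rw [mat_x, vecMul_add, vecMul_one, vecMul_smul, rowVec_vecMul_e_last, rowVec_smul, rowVec_add]
  refine rowVec_congr (fun b _ => by simp) (fun b _ => ?_)
  simp only [Pi.add_apply, Pi.smul_apply, smul_eq_mul]
  split_ifs with h <;> simp [h]

theorem rowVec_vecMul_y {n j : ℕ} (hj : j + 1 < n) (t : ℂ) (P Q : ℕ → ℂ) :
    rowVec n P Q ᵥ* mat (y n (j + 1) t) =
      rowVec n (fun b => if b = j then P j + t * P (j + 1) else P b)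
        (fun b => if b = j + 1 then Q (j + 1) + t * Q j else Q b) := by
  rw [mat_y, vecMul_add, vecMul_one, vecMul_smul, rowVec_vecMul_f hj, rowVec_smul, rowVec_add]
  refine rowVec_congr (fun b _ => ?_) (fun b _ => ?_) <;>
    simp only [Pi.add_apply, Pi.smul_apply, smul_eq_mul] <;> split_ifs with h <;> simp [h]

theorem rowVec_vecMul_y_last (m : ℕ) (t : ℂ) (P Q : ℕ → ℂ) :
    rowVec (m + 1) P Q ᵥ* mat (y (m + 1) (m + 1) t) =
      rowVec (m + 1) (fun b => if b = m then P m + t * Q m else P b) Q := by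
  rw [mat_y, vecMul_add, vecMul_one, vecMul_smul, rowVec_vecMul_f_last, rowVec_smul, rowVec_add]
  refine rowVec_congr (fun b _ => ?_) (fun b _ => by simp)
  simp only [Pi.add_apply, Pi.smul_apply, smul_eq_mul]
  split_ifs with h <;> simp [h]

theorem rowVec_vecMul_coroot {n j : ℕ} (c : ℂˣ) (P Q : ℕ → ℂ) :
    rowVec n P Q ᵥ* mat (coroot n (j + 1) c) =
      rowVec n (fun b => if b = j then c * P b else if b = j + 1 then (c : ℂ)⁻¹ * P b else P b)
        (fun b => if b = j then (c : ℂ)⁻¹ * Q b else if b = j + 1 then c * Q b else Q b) := by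
  funext a
  rw [mat_coroot, vecMul_diagonal]
  rcases a with a | a <;> simp only [rowVec_inl, rowVec_inr, hWeight, add_left_inj]
  all_goals
    split_ifs with h1 h2 h2
    · omega
    · simp [mul_comm]
    · simp [mul_comm]
    · simp

theorem rowVec_vecMul_sBar {n j : ℕ} (hj : j + 1 < n) (P Q : ℕ → ℂ) :
    rowVec n P Q ᵥ* mat (sBar n (j + 1)) =
      rowVec n (fun b => if b = j then P (j + 1) else if b = j + 1 then -P j else P b)
        (fun b => if b = j then -Q (j + 1) else if b = j + 1 then Q j else Q b) := by
  rw [sBar, mat_mul, mat_mul, ← vecMul_vecMul, ← vecMul_vecMul, rowVec_vecMul_x hj,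
    rowVec_vecMul_y hj, rowVec_vecMul_x hj]
  refine rowVec_congr (fun b _ => ?_) (fun b _ => ?_)
  all_goals
    by_cases h1 : b = j
    · subst h1; simp
    · by_cases h2 : b = j + 1
      · subst h2; simp
      · simp [h1, h2]

theorem rowVec_vecMul_sBar_last (m : ℕ) (P Q : ℕ → ℂ) :
    rowVec (m + 1) P Q ᵥ* mat (sBar (m + 1) (m + 1)) =
      rowVec (m + 1) (fun b => if b = m then Q m else P b)
        (fun b => if b = m then -P m else Q b) := by
  rw [sBar, mat_mul, mat_mul, ← vecMul_vecMul, ← vecMul_vecMul, rowVec_vecMul_x_last,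
    rowVec_vecMul_y_last, rowVec_vecMul_x_last]
  refine rowVec_congr (fun b _ => ?_) (fun b _ => ?_)
  all_goals
    by_cases h1 : b = m
    · subst h1; simp
    · simp [h1]

theorem rowVec_vecMul_yBold {n j : ℕ} (hj : j + 1 < n) (c : ℂˣ) (P Q : ℕ → ℂ) :
    rowVec n P Q ᵥ* mat (yBold n (j + 1) c) =
      rowVec n
        (fun b => if b = j then (c : ℂ)⁻¹ * P j + P (j + 1) else
          if b = j + 1 then c * P (j + 1) else P b)
        (fun b => if b = j then c * Q j else
          if b = j + 1 then (c : ℂ)⁻¹ * Q (j + 1) + Q j else Q b) := by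
  rw [yBold, mat_mul, ← vecMul_vecMul, rowVec_vecMul_y hj, rowVec_vecMul_coroot]
  refine rowVec_congr (fun b _ => ?_) (fun b _ => ?_)
  all_goals
    by_cases h1 : b = j
    · subst h1; simp [mul_add]
    · by_cases h2 : b = j + 1
      · subst h2; simp [mul_add]
      · simp [h1, h2]

theorem rowVec_vecMul_yBold_last (m : ℕ) (c : ℂˣ) (P Q : ℕ → ℂ) :
    rowVec (m + 1) P Q ᵥ* mat (yBold (m + 1) (m + 1) c) =
      rowVec (m + 1) (fun b => if b = m then (c : ℂ)⁻¹ * P m + Q m else P b)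
        (fun b => if b = m then c * Q m else Q b) := by
  rw [yBold, mat_mul, ← vecMul_vecMul, rowVec_vecMul_y_last, rowVec_vecMul_coroot]
  refine rowVec_congr (fun b hb => ?_) (fun b hb => ?_)
  all_goals
    by_cases h1 : b = m
    · subst h1; simp [mul_add]
    · simp [h1, show b ≠ m + 1 by omega]

/-- This is the identity `[[t, -1], [1, 0]] = y(t⁻¹) diag(t, t⁻¹) x(-t⁻¹)` in `SL₂`, transported to
`G`. -/
theorem x_mul_sBar {n k : ℕ} (hk : 1 ≤ k) (hkn : k ≤ n) (t : ℂˣ) :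
    x n k t * sBar n k = y n k (t : ℂ)⁻¹ * coroot n k t * x n k (-(t : ℂ)⁻¹) := by
  obtain ⟨j, rfl⟩ : ∃ j, k = j + 1 := ⟨k - 1, by omega⟩
  refine eq_of_forall_rowVec fun P Q => ?_
  have ht : (t : ℂ) ≠ 0 := t.ne_zero
  simp only [mat_mul, ← vecMul_vecMul]
  rcases Nat.lt_or_ge (j + 1) n with hj | hj
  · simp only [rowVec_vecMul_x hj, rowVec_vecMul_sBar hj, rowVec_vecMul_y hj, rowVec_vecMul_coroot]
    refine rowVec_congr (fun b _ => ?_) (fun b _ => ?_)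
    all_goals
      by_cases h1 : b = j
      · subst h1; simp; try (field_simp; try ring)
      · by_cases h2 : b = j + 1
        · subst h2; simp; try (field_simp; try ring)
        · simp [h1, h2]
  · obtain rfl : n = j + 1 := by omega
    simp only [rowVec_vecMul_x_last, rowVec_vecMul_sBar_last, rowVec_vecMul_y_last,
      rowVec_vecMul_coroot]
    refine rowVec_congr (fun b hb => ?_) (fun b hb => ?_)
    all_goals
      by_cases h1 : b = j
      · subst h1; simp; try (field_simp; try ring)
      · simp [h1, show b ≠ j + 1 by omega]

/-! ### Unitriangular elements. -/

theorem pos_injective (n : ℕ) : Function.Injective (pos n) := by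
  rintro (a | a) (b | b) h <;> simp only [pos] at h
  · exact congrArg Sum.inl (Fin.ext h)
  · omega
  · omega
  · exact congrArg Sum.inr (Fin.ext (by omega))

theorem blockTriangular_mul_apply_self {m α : Type*} [Fintype m] [LinearOrder α] {b : m → α}
    (hb : Function.Injective b) {M N : Matrix m m ℂ} (hM : M.BlockTriangular b)
    (hN : N.BlockTriangular b) (a : m) : (M * N) a a = M a a * N a a := by
  rw [Matrix.mul_apply]
  refine Finset.sum_eq_single_of_mem a (Finset.mem_univ _) fun c _ hc => ?_
  rcases lt_or_gt_of_ne (hb.ne hc) with h | h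
  · rw [hM h, zero_mul]
  · rw [hN h, mul_zero]

theorem IsUPlus.blockTriangular {n : ℕ} {g : G n} (hg : IsUPlus g) :
    (mat g).BlockTriangular (pos n) := fun a b h => hg.2 a b h

theorem IsUMinus.blockTriangular {n : ℕ} {g : G n} (hg : IsUMinus g) :
    (mat g).BlockTriangular (OrderDual.toDual ∘ pos n) := fun a b h => hg.2 a b h

theorem IsUPlus.mul {n : ℕ} {g h : G n} (hg : IsUPlus g) (hh : IsUPlus h) : IsUPlus (g * h) := by
  refine ⟨fun a => ?_, fun a b hab => ?_⟩
  · rw [mat_mul, blockTriangular_mul_apply_self (pos_injective n) hg.blockTriangular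
      hh.blockTriangular, hg.1, hh.1, mul_one]
  · exact hg.blockTriangular.mul hh.blockTriangular hab

theorem IsUMinus.mul {n : ℕ} {g h : G n} (hg : IsUMinus g) (hh : IsUMinus h) :
    IsUMinus (g * h) := by
  refine ⟨fun a => ?_, fun a b hab => ?_⟩
  · rw [mat_mul, blockTriangular_mul_apply_self
      (b := OrderDual.toDual ∘ pos n) (OrderDual.toDual.injective.comp (pos_injective n))
      hg.blockTriangular hh.blockTriangular, hg.1, hh.1, mul_one]
  · exact hg.blockTriangular.mul hh.blockTriangular hab

theorem e_apply_eq_zero (n i : ℕ) (a b : Idx n) (h : pos n b ≤ pos n a) : e n i a b = 0 := by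
  rcases a with a | a <;> rcases b with b | b <;> simp only [pos] at h <;> simp [e] <;> omega

theorem isUPlus_x (n i : ℕ) (t : ℂ) : IsUPlus (x n i t) := by
  refine ⟨fun a => ?_, fun a b h => ?_⟩
  · simp [mat_x, e_apply_eq_zero n i a a le_rfl]
  · simp [mat_x, e_apply_eq_zero n i a b h.le,
      show a ≠ b from fun hab => by simp [hab] at h]

theorem isUMinus_y (n i : ℕ) (t : ℂ) : IsUMinus (y n i t) := by
  refine ⟨fun a => ?_, fun a b h => ?_⟩
  · simp [mat_y, f_eq, e_apply_eq_zero n i a a le_rfl]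
  · simp [mat_y, f_eq, e_apply_eq_zero n i b a h.le,
      show a ≠ b from fun hab => by simp [hab] at h]

/-! ### Gauss decomposition from the first `n` rows. -/

theorem formSign_mul_formSign (n : ℕ) : formSign n * formSign n = 1 := by
  rw [formSign, diagonal_mul_diagonal, ← diagonal_one]
  congr 1
  funext a
  rw [← mul_pow]
  simp

theorem form_mul_form (n : ℕ) : form n * form n = -1 := by
  rw [form, fromBlocks_multiply, ← fromBlocks_one, fromBlocks_neg]
  simp [formSign_mul_formSign]

theorem transpose_mul_form_mul {n : ℕ} (g : G n) : (mat g)ᵀ * form n * mat g = form n := g.2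

theorem mul_form_mul_transpose {n : ℕ} (g : G n) : mat g * form n * (mat g)ᵀ = form n := by
  have h1 : (-(form n * (mat g)ᵀ * form n)) * mat g = 1 := by
    rw [neg_mul, Matrix.mul_assoc, Matrix.mul_assoc, ← Matrix.mul_assoc _ _ (mat g),
      transpose_mul_form_mul, form_mul_form, neg_neg]
  have h2 := mul_eq_one_comm.mp h1
  calc mat g * form n * (mat g)ᵀ
      = -(mat g * form n * (mat g)ᵀ * (form n * form n)) := by rw [form_mul_form]; simp
    _ = (mat g * -(form n * (mat g)ᵀ * form n)) * form n := by
        simp only [Matrix.mul_assoc, mul_neg, neg_mul]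
    _ = form n := by rw [h2, one_mul]

/-- The inverse of an upper unitriangular matrix is upper unitriangular. -/
theorem inv_upper_unitriangular {n : ℕ} {r : Matrix (Fin n) (Fin n) ℂ} (hr1 : ∀ a, r a a = 1)
    (hr : ∀ a b, b < a → r a b = 0) :
    r * r⁻¹ = 1 ∧ (∀ a, r⁻¹ a a = 1) ∧ ∀ a b, b < a → r⁻¹ a b = 0 := by
  have hbt : r.BlockTriangular id := fun a b h => hr a b h
  have hdet : r.det = 1 := by
    rw [Matrix.det_of_isUpperTriangular (M := r) (fun a b h => hr a b h)]
    simp [hr1]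
  have hu : IsUnit r.det := by rw [hdet]; exact isUnit_one
  have := Matrix.invertibleOfIsUnitDet r hu
  have hinv := blockTriangular_inv_of_blockTriangular hbt
  refine ⟨Matrix.mul_nonsing_inv r hu, fun a => ?_, fun a b h => hinv h⟩
  have := blockTriangular_mul_apply_self Function.injective_id hbt hinv a
  rw [Matrix.mul_nonsing_inv r hu, hr1, one_mul, Matrix.one_apply_eq] at this
  exact this.symm

theorem transpose_formSign {n : ℕ} : (formSign n)ᵀ = formSign n := by
  simp [formSign]

/-- An element of `G` whose first `n` rows are `l * [r | b]` with `l` lower and `r` upper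
unitriangular lies in `U⁻ U⁺`, and `[r | b]` are the first `n` rows of its `U⁺`-part. -/
theorem exists_uMinus_mul_uPlus {n : ℕ} (g : G n) (l r b : Matrix (Fin n) (Fin n) ℂ)
    (hl1 : ∀ a, l a a = 1) (hl : ∀ a b, a < b → l a b = 0)
    (hr1 : ∀ a, r a a = 1) (hr : ∀ a b, b < a → r a b = 0)
    (hA : (mat g).toBlocks₁₁ = l * r) (hB : (mat g).toBlocks₁₂ = l * b) :
    ∃ u v : G n, IsUMinus u ∧ IsUPlus v ∧ g = u * v ∧
      (mat v).toBlocks₁₁ = r ∧ (mat v).toBlocks₁₂ = b := by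
  obtain ⟨hrr, hri1, hri⟩ := inv_upper_unitriangular hr1 hr
  obtain ⟨hll, hli1, hli⟩ := inv_upper_unitriangular (r := lᵀ) hl1 (fun a b h => hl b a h)
  set D := formSign n with hD
  have hDD : D * D = 1 := formSign_mul_formSign n
  have hDT : Dᵀ = D := transpose_formSign
  have hl' : (lᵀ⁻¹)ᵀ * l = 1 := by
    rw [mul_eq_one_comm, ← transpose_transpose l, ← transpose_mul, transpose_transpose]
    rw [mul_eq_one_comm.mp hll, transpose_one]
  have hr' : r⁻¹ * r = 1 := mul_eq_one_comm.mp hrr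
  -- The first `n` rows of `g` span an isotropic subspace; cancelling the invertible `l` gives the
  -- same for the rows of `[r | b]`.
  have hiso : r * D * bᵀ = b * D * rᵀ := by
    have h := congrArg toBlocks₁₁ (mul_form_mul_transpose g)
    rw [← fromBlocks_toBlocks (mat g), hA, hB, form, fromBlocks_transpose, fromBlocks_multiply,
      fromBlocks_multiply] at h
    simp only [toBlocks_fromBlocks₁₁, mul_zero, zero_add, add_zero, mul_neg, neg_mul,
      transpose_mul, ← hD] at h
    have h2 : l * (r * D * bᵀ - b * D * rᵀ) * lᵀ = 0 := by
      rw [← h]; noncomm_ring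
    have h3 : (lᵀ⁻¹)ᵀ * (l * (r * D * bᵀ - b * D * rᵀ) * lᵀ) * lᵀ⁻¹ = r * D * bᵀ - b * D * rᵀ := by
      calc _ = ((lᵀ⁻¹)ᵀ * l) * (r * D * bᵀ - b * D * rᵀ) * (lᵀ * lᵀ⁻¹) := by
            simp only [Matrix.mul_assoc]
        _ = _ := by rw [hl', hll]; simp
    rw [h2] at h3
    simp only [mul_zero, zero_mul] at h3
    exact sub_eq_zero.mp h3.symm
  -- With lower left block `0`, the form equation `rᵀ D s = D` forces this `s`.
  set s := D * r⁻¹ᵀ * D with hs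
  have hrs : rᵀ * D * s = D := by
    calc rᵀ * D * s = rᵀ * (D * D) * r⁻¹ᵀ * D := by simp only [hs, Matrix.mul_assoc]
      _ = (r⁻¹ * r)ᵀ * D := by rw [hDD, transpose_mul]; simp
      _ = D := by rw [hr']; simp
  have hsr : sᵀ * D * r = D := by
    have := congrArg transpose hrs
    simpa [transpose_mul, hDT, Matrix.mul_assoc] using this
  have hbs : bᵀ * D * s = sᵀ * D * b := by
    have h1 : bᵀ * D * s = bᵀ * r⁻¹ᵀ * D := by
      calc bᵀ * D * s = bᵀ * (D * D) * r⁻¹ᵀ * D := by simp only [hs, Matrix.mul_assoc]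
        _ = _ := by rw [hDD]; simp
    have h2 : sᵀ * D * b = D * r⁻¹ * b := by
      calc sᵀ * D * b = D * r⁻¹ * (D * D) * b := by
            simp only [hs, Matrix.mul_assoc, transpose_mul, hDT, transpose_transpose]
        _ = _ := by rw [hDD]; simp
    have hrr2 : rᵀ * r⁻¹ᵀ = 1 := by rw [← transpose_mul, hr', transpose_one]
    rw [h1, h2]
    calc bᵀ * r⁻¹ᵀ * D = D * (r⁻¹ * r) * D * bᵀ * r⁻¹ᵀ * D := by rw [hr']; simp [hDD]
      _ = D * r⁻¹ * (r * D * bᵀ) * r⁻¹ᵀ * D := by simp only [Matrix.mul_assoc]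
      _ = D * r⁻¹ * b * D * (rᵀ * r⁻¹ᵀ) * D := by rw [hiso]; simp only [Matrix.mul_assoc]
      _ = D * r⁻¹ * b * (D * D) := by rw [hrr2]; simp only [Matrix.mul_assoc, one_mul]
      _ = D * r⁻¹ * b := by rw [hDD, mul_one]
  have hRG : (fromBlocks r b 0 s)ᵀ * form n * fromBlocks r b 0 s = form n := by
    rw [form, ← hD, fromBlocks_transpose, fromBlocks_multiply, fromBlocks_multiply]
    congr 1
    · simp
    · simpa using hrs
    · simpa using hsr
    · simp [hbs]
  have hleft : -(form n * (fromBlocks r b 0 s)ᵀ * form n) * fromBlocks r b 0 s = 1 := by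
    rw [neg_mul, Matrix.mul_assoc, Matrix.mul_assoc, ← Matrix.mul_assoc _ _ (fromBlocks r b 0 s),
      hRG, form_mul_form, neg_neg]
  let v : G n := ⟨⟨fromBlocks r b 0 s, -(form n * (fromBlocks r b 0 s)ᵀ * form n),
    mul_eq_one_comm.mp hleft, hleft⟩, hRG⟩
  have hv : mat v = fromBlocks r b 0 s := rfl
  have hsdiag : ∀ a b, s a b = (-1) ^ (a.val + 1) * r⁻¹ b a * (-1) ^ (b.val + 1) := by
    intro a b
    rw [hs, hD, formSign, mul_diagonal, diagonal_mul, transpose_apply]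
  have hvU : IsUPlus v := by
    refine ⟨?_, ?_⟩
    · rintro (a | a)
      · rw [hv]; exact hr1 a
      · rw [hv, fromBlocks_apply₂₂, hsdiag, hri1, mul_one, ← mul_pow]; simp
    · rintro (a | a) (b | b) h <;> rw [hv] <;> simp only [pos] at h
      · exact hr _ _ h
      · omega
      · rfl
      · rw [fromBlocks_apply₂₂, hsdiag, hri b a (by rw [Fin.lt_def]; omega)]; simp
  have hu : mat (g * v⁻¹) * mat v = mat g := by
    rw [← mat_mul, inv_mul_cancel_right]
  have hss : IsUnit s := by
    refine IsUnit.of_mul_eq_one (D * rᵀ * D) (mul_eq_one_comm.mp ?_)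
    calc D * rᵀ * D * s = D * (rᵀ * D * s) := by simp only [Matrix.mul_assoc]
      _ = 1 := by rw [hrs, hDD]
  set w := mat (g * v⁻¹) with hw
  have h11 : w.toBlocks₁₁ = l := by
    have h := congrArg toBlocks₁₁ hu
    rw [hv, ← fromBlocks_toBlocks w, fromBlocks_multiply, hA] at h
    simp only [toBlocks_fromBlocks₁₁, mul_zero, add_zero] at h
    have := congrArg (· * r⁻¹) h
    simpa [Matrix.mul_assoc, hrr] using this
  have h12 : w.toBlocks₁₂ = 0 := by
    have h := congrArg toBlocks₁₂ hu
    rw [hv, ← fromBlocks_toBlocks w, fromBlocks_multiply, hB] at h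
    simp only [toBlocks_fromBlocks₁₂, h11] at h
    exact (hss.mul_left_eq_zero).mp (add_eq_left.mp h)
  have h22 : w.toBlocks₂₂ = D * lᵀ⁻¹ * D := by
    have h := congrArg toBlocks₁₂ (transpose_mul_form_mul (g * v⁻¹))
    rw [← hw, ← fromBlocks_toBlocks w, h11, h12, form, fromBlocks_transpose, fromBlocks_multiply,
      fromBlocks_multiply] at h
    simp only [toBlocks_fromBlocks₁₂, mul_zero, zero_add, ← hD,
      zero_mul, add_zero, transpose_zero] at h
    calc w.toBlocks₂₂ = D * (lᵀ⁻¹ * lᵀ) * D * w.toBlocks₂₂ := by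
          rw [mul_eq_one_comm.mp hll, mul_one, hDD, one_mul]
      _ = D * lᵀ⁻¹ * (lᵀ * D * w.toBlocks₂₂) := by simp only [Matrix.mul_assoc]
      _ = _ := by rw [h]
  have hwdiag : ∀ a b, w (Sum.inr a) (Sum.inr b) =
      (-1) ^ (a.val + 1) * lᵀ⁻¹ a b * (-1) ^ (b.val + 1) := by
    intro a b
    change w.toBlocks₂₂ a b = _
    rw [h22, hD, formSign, mul_diagonal, diagonal_mul]
  refine ⟨g * v⁻¹, v, ⟨?_, ?_⟩, hvU, by rw [inv_mul_cancel_right], ?_, ?_⟩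
  · rintro (a | a)
    · exact (congrFun (congrFun h11 a) a).trans (hl1 a)
    · rw [← hw, hwdiag, hli1, mul_one, ← mul_pow]; simp
  · rintro (a | a) (b | b) h <;> simp only [pos] at h
    · exact (congrFun (congrFun h11 a) b).trans (hl _ _ h)
    · exact congrFun (congrFun h12 a) b
    · omega
    -- The barred basis vectors are ordered backwards by `pos`, so the upper triangular `lᵀ⁻¹`
    -- becomes lower triangular there.
    · rw [← hw, hwdiag, hli a b (by rw [Fin.lt_def]; omega)]; simp
  · rw [hv, toBlocks_fromBlocks₁₁]
  · rw [hv, toBlocks_fromBlocks₁₂]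

/-! ### The principal minor on `U⁻ U⁺ \bar s_k`. -/

theorem isTorus_coroot (n i : ℕ) (c : ℂˣ) : IsTorus (coroot n i c) := by
  intro a b h
  rw [mat_coroot, diagonal_apply_ne _ h]

theorem fundWeight_coroot {n k : ℕ} (hk : 1 ≤ k) (hkn : k ≤ n) (c : ℂˣ) :
    fundWeight n k (coroot n k c) = c := by
  rw [fundWeight, Finset.prod_eq_single_of_mem
    (⟨⟨k - 1, by omega⟩, by simp; omega⟩ : {a : Fin n // a.val + 1 ≤ k}) (Finset.mem_univ _)]
  · rw [mat_coroot, diagonal_apply_eq]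
    simp [hWeight, show k - 1 + 1 = k by omega, show k - 1 ≠ k by omega]
  · rintro ⟨a, ha⟩ _ hne
    have h1 : a.val + 1 ≠ k := fun h => hne (Subtype.ext (Fin.ext (by simp; omega)))
    rw [mat_coroot, diagonal_apply_eq]
    simp [hWeight, h1, show a.val ≠ k by omega]

/-- The value of the principal minor on `U⁻ x_k(t) \bar s_k U⁺`. -/
theorem IsPrincipalMinor.apply_mul_x_mul_sBar_mul {n k : ℕ} (hk : 1 ≤ k) (hkn : k ≤ n)
    {F : G n → ℂ} (hF : IsPrincipalMinor (fundWeight n k) F) {u v : G n} (hu : IsUMinus u)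
    (hv : IsUPlus v) (t : ℂ) : F (u * x n k t * sBar n k * v) = t := by
  have hne : ∀ t : ℂ, t ≠ 0 → F (u * x n k t * sBar n k * v) = t := by
    intro t ht
    have h := x_mul_sBar hk hkn (Units.mk0 t ht)
    rw [Units.val_mk0] at h
    have h2 : u * x n k t * sBar n k * v =
        (u * y n k t⁻¹) * coroot n k (Units.mk0 t ht) * (x n k (-t⁻¹) * v) := by
      rw [mul_assoc u, h]
      simp only [mul_assoc]
    rw [h2, hF.2 _ _ _ (hu.mul (isUMinus_y n k _)) (isTorus_coroot n k _)
      ((isUPlus_x n k _).mul hv), fundWeight_coroot hk hkn, Units.val_mk0]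
  obtain ⟨p, hp⟩ := hF.1
  -- At `t = 0` the element need not lie in `U⁻ T U⁺`; both sides are continuous in `t` and agree on
  -- the dense set `t ≠ 0`.
  have hcont : Continuous fun t : ℂ => F (u * x n k t * sBar n k * v) := by
    simp only [hp, mat_mul, mat_x]
    refine (MvPolynomial.continuous_eval p).comp (continuous_pi fun ab => ?_)
    refine Continuous.matrix_elem (A := fun t : ℂ =>
      mat u * (1 + t • e n k) * mat (sBar n k) * mat v) ?_ _ _
    fun_prop
  exact congrFun (Continuous.ext_on (dense_compl_singleton (0 : ℂ)) hcont continuous_id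
    fun t ht => hne t ht) t

/-- Conjugation of an element of `U⁺` by a monomial matrix. -/
theorem IsUPlus.conj_of_monomial {n : ℕ} {g u : G n} (σ : Idx n → Idx n) (ε : Idx n → ℂ)
    (hg : ∀ ξ b, (ξ ᵥ* mat g) b = ε b * ξ (σ b)) (hσ : Function.Involutive σ)
    (hε : ∀ b, ε b * ε b = 1) (hu : IsUPlus u)
    (hpos : ∀ a b, pos n b < pos n a → pos n (σ b) < pos n (σ a) ∨ mat u (σ a) (σ b) = 0) :
    IsUPlus (g⁻¹ * u * g) := by
  have hrow : ∀ a, (Pi.single a 1 : Idx n → ℂ) ᵥ* mat g⁻¹ = Pi.single (σ a) (ε a) := by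
    intro a
    have h : (Pi.single a 1 : Idx n → ℂ) = Pi.single (σ a) (ε a) ᵥ* mat g := by
      funext b
      rw [hg]
      by_cases hab : b = a
      · subst hab; simp [hε]
      · simp [hab, hσ.injective.ne hab]
    rw [h, vecMul_vecMul, mat_mul_mat_inv, vecMul_one]
  have hentry : ∀ a b, mat (g⁻¹ * u * g) a b = ε a * ε b * mat u (σ a) (σ b) := by
    intro a b
    have h1 : mat (g⁻¹ * u * g) a b =
        (((Pi.single a 1 : Idx n → ℂ) ᵥ* mat g⁻¹) ᵥ* mat u ᵥ* mat g) b := by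
      rw [vecMul_vecMul, vecMul_vecMul, mat_mul, mat_mul, Matrix.mul_assoc]
      simp
    rw [h1, hrow, hg, single_vecMul]
    simp only [Pi.smul_apply, row_apply, smul_eq_mul]
    ring
  refine ⟨fun a => ?_, fun a b h => ?_⟩
  · rw [hentry, hε, hu.1, mul_one]
  · rw [hentry]
    rcases hpos a b h with h' | h'
    · rw [hu.2 _ _ h', mul_zero]
    · rw [h', mul_zero]

/-- The two matrix entries of an element of `U⁺` at the simple root `α_i`, `i < n`, agree. -/
theorem IsUPlus.apply_inr_eq {n j : ℕ} (hj : j + 1 < n) {v : G n} (hv : IsUPlus v) :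
    mat v (Sum.inr ⟨j + 1, hj⟩) (Sum.inr ⟨j, by omega⟩) =
      mat v (Sum.inl ⟨j, by omega⟩) (Sum.inl ⟨j + 1, hj⟩) := by
  have h21 : (mat v).toBlocks₂₁ = 0 := by
    ext a b
    exact hv.2 _ _ (by simp only [pos]; omega)
  have h := congrArg toBlocks₁₂ (transpose_mul_form_mul v)
  rw [← fromBlocks_toBlocks (mat v), h21, form, fromBlocks_transpose, fromBlocks_multiply,
    fromBlocks_multiply] at h
  simp only [toBlocks_fromBlocks₁₂, mul_zero, zero_add, zero_mul, transpose_zero, add_zero] at h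
  have h' := congrFun (congrFun h ⟨j + 1, hj⟩) ⟨j, by omega⟩
  -- In this off-diagonal entry of `vᵀ J v = J`, triangularity leaves only the summands at `j` and
  -- `j + 1`, which must cancel.
  rw [Matrix.mul_apply, Finset.sum_eq_add (⟨j, by omega⟩ : Fin n) ⟨j + 1, hj⟩ (by simp)] at h'
  · simp only [formSign, mul_diagonal, transpose_apply, toBlocks₁₁, toBlocks₂₂, of_apply, hv.1] at h'
    rw [diagonal_apply_ne _ (by simp)] at h'
    have hz : ((-1 : ℂ) ^ (j + 1)) ≠ 0 := by simp
    rw [pow_succ (-1 : ℂ) (j + 1)] at h'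
    apply mul_left_cancel₀ hz
    linear_combination -h'
  · intro a _ ha
    simp only [formSign, mul_diagonal, transpose_apply, toBlocks₁₁, toBlocks₂₂, of_apply]
    rcases Nat.lt_or_ge a.val j with h1 | h1
    · rw [hv.2 (Sum.inr a) (Sum.inr ⟨j, by omega⟩) (by simp only [pos]; omega), mul_zero]
    · have h2 : j + 1 < a.val := by
        have h3 : a.val ≠ j := fun h => ha.1 (Fin.ext h)
        have h4 : a.val ≠ j + 1 := fun h => ha.2 (Fin.ext h)
        omega
      rw [hv.2 (Sum.inl a) (Sum.inl ⟨j + 1, hj⟩) (by simpa only [pos] using h2), zero_mul, zero_mul]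
  · simp
  · simp

theorem IsUPlus.conj_sBar {n j : ℕ} (hj : j + 1 < n) {v : G n} (hv : IsUPlus v)
    (h0 : mat v (Sum.inl ⟨j, by omega⟩) (Sum.inl ⟨j + 1, hj⟩) = 0) :
    IsUPlus ((sBar n (j + 1))⁻¹ * v * sBar n (j + 1)) := by
  set p : Fin n := ⟨j, by omega⟩ with hp
  set q : Fin n := ⟨j + 1, hj⟩ with hq
  have hpq : p ≠ q := by simp [hp, hq]
  have hval : ∀ a : Fin n, (Equiv.swap p q a).val =
      if a.val = j then j + 1 else if a.val = j + 1 then j else a.val := by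
    intro a
    rw [Equiv.swap_apply_def]
    simp only [Fin.ext_iff, hp, hq]
    split_ifs <;> simp
  refine hv.conj_of_monomial (Sum.map (Equiv.swap p q) (Equiv.swap p q))
    (Sum.elim (fun a => if a.val = j + 1 then -1 else 1) (fun a => if a.val = j then -1 else 1))
    ?_ ?_ ?_ ?_
  · intro ξ b
    obtain ⟨P, Q, rfl⟩ := exists_rowVec ξ
    rw [rowVec_vecMul_sBar hj]
    rcases b with b | b <;> simp only [rowVec_inl, rowVec_inr, Sum.map_inl, Sum.map_inr,
      Sum.elim_inl, Sum.elim_inr, hval]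
    all_goals
      by_cases h1 : b.val = j
      · simp [h1]
      · by_cases h2 : b.val = j + 1
        · simp [h2]
        · simp [h1, h2]
  · rintro (a | a) <;> simp
  · rintro (a | a) <;> simp only [Sum.elim_inl, Sum.elim_inr] <;> split_ifs <;> simp
  · have hinr := hv.apply_inr_eq hj
    rw [← hp, ← hq, h0] at hinr
    rintro (a | a) (b | b) h <;> simp only [Sum.map_inl, Sum.map_inr, pos, hval] at h ⊢
    -- An adjacent transposition reverses the order of a single pair, where the entry of `v`
    -- vanishes by hypothesis.
    · by_cases hab : b.val = j ∧ a.val = j + 1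
      · right
        rw [show a = q from Fin.ext hab.2, show b = p from Fin.ext hab.1]
        simpa using h0
      · left
        split_ifs <;> omega
    · omega
    · left; split_ifs <;> omega
    · by_cases hab : a.val = j ∧ b.val = j + 1
      · right
        rw [show a = p from Fin.ext hab.1, show b = q from Fin.ext hab.2]
        simpa using hinr
      · left
        split_ifs <;> omega

theorem IsUPlus.conj_sBar_last {m : ℕ} {v : G (m + 1)} (hv : IsUPlus v)
    (h0 : mat v (Sum.inl (Fin.last m)) (Sum.inr (Fin.last m)) = 0) :
    IsUPlus ((sBar (m + 1) (m + 1))⁻¹ * v * sBar (m + 1) (m + 1)) := by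
  refine hv.conj_of_monomial
    (Sum.elim (fun a => if a.val = m then Sum.inr a else Sum.inl a)
      (fun a => if a.val = m then Sum.inl a else Sum.inr a))
    (Sum.elim (fun _ => 1) (fun a => if a.val = m then -1 else 1)) ?_ ?_ ?_ ?_
  · intro ξ b
    obtain ⟨P, Q, rfl⟩ := exists_rowVec ξ
    rw [rowVec_vecMul_sBar_last]
    rcases b with b | b <;> by_cases h : b.val = m <;> simp [h]
  · rintro (a | a) <;> by_cases h : a.val = m <;> simp [h]
  · rintro (a | a)
    · simp
    · by_cases h : a.val = m <;> simp [h]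
  · rintro (a | a) (b | b) h <;> simp only [Sum.elim_inl, Sum.elim_inr, pos] at h ⊢
    · left; split_ifs <;> dsimp only <;> omega
    · omega
    · by_cases hab : a.val = m ∧ b.val = m
      · right
        rw [if_pos hab.1, if_pos hab.2, show a = Fin.last m from Fin.ext hab.1,
          show b = Fin.last m from Fin.ext hab.2, h0]
      · left; split_ifs <;> dsimp only <;> omega
    · left; split_ifs <;> dsimp only <;> omega

/-- If the coordinate of `x_k(-a) v` at the simple root `α_k` vanishes, then the principal minor
takes the value `a` at `u v \bar s_k`. -/
theorem IsPrincipalMinor.apply_mul_mul_sBar_of_conj {n k : ℕ} (hk : 1 ≤ k) (hkn : k ≤ n)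
    {F : G n → ℂ} (hF : IsPrincipalMinor (fundWeight n k) F) {u v : G n} (hu : IsUMinus u) (a : ℂ)
    (hv : IsUPlus ((sBar n k)⁻¹ * (x n k (-a) * v) * sBar n k)) :
    F (u * v * sBar n k) = a := by
  have hx : x n k a * x n k (-a) = 1 := by
    refine mat_injective ?_
    rw [mat_mul, mat_x, mat_x, mat_one]
    simp only [mul_add, add_mul, mul_one, one_mul, smul_mul_smul_comm, e_sq]
    simp
  have h := hF.apply_mul_x_mul_sBar_mul hk hkn hu hv a
  rw [← h]
  congr 1
  calc u * v * sBar n k = u * (x n k a * x n k (-a)) * v * sBar n k := by rw [hx, mul_one]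
    _ = _ := by group

/-- Multiplying by `x_k(-a)` on the left subtracts `a` times row `v_{k+1}` from row `v_k`. As the
diagonal of `v` is `1`, taking for `a` the entry at `(v_k, v_{k+1})` kills that entry. -/
theorem IsPrincipalMinor.apply_mul_mul_sBar {n j : ℕ} (hj : j + 1 < n) {F : G n → ℂ}
    (hF : IsPrincipalMinor (fundWeight n (j + 1)) F) {u v : G n} (hu : IsUMinus u)
    (hv : IsUPlus v) : F (u * v * sBar n (j + 1)) =
      mat v (Sum.inl ⟨j, by omega⟩) (Sum.inl ⟨j + 1, hj⟩) := by
  refine hF.apply_mul_mul_sBar_of_conj (by omega) (by omega) hu _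
    (((isUPlus_x _ _ _).mul hv).conj_sBar hj ?_)
  have he : ∀ c, e n (j + 1) (Sum.inl ⟨j, by omega⟩) c =
      if c = Sum.inl ⟨j + 1, hj⟩ then 1 else 0 := by
    rintro (c | c)
    · simp [e, Fin.ext_iff]
    · simp [e]; omega
  rw [mat_mul, mat_x, Matrix.add_mul, Matrix.one_mul, Matrix.smul_mul, Matrix.add_apply,
    Matrix.smul_apply, Matrix.mul_apply]
  simp [he, hv.1]

theorem IsPrincipalMinor.apply_mul_mul_sBar_last {m : ℕ} {F : G (m + 1) → ℂ}
    (hF : IsPrincipalMinor (fundWeight (m + 1) (m + 1)) F) {u v : G (m + 1)} (hu : IsUMinus u)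
    (hv : IsUPlus v) : F (u * v * sBar (m + 1) (m + 1)) =
      mat v (Sum.inl (Fin.last m)) (Sum.inr (Fin.last m)) := by
  refine hF.apply_mul_mul_sBar_of_conj (by omega) le_rfl hu _
    (((isUPlus_x _ _ _).mul hv).conj_sBar_last ?_)
  have he : ∀ c, e (m + 1) (m + 1) (Sum.inl (Fin.last m)) c =
      if c = Sum.inr (Fin.last m) then 1 else 0 := by
    rintro (c | c)
    · simp [e]; omega
    · simp [e, Fin.ext_iff]
  rw [mat_mul, mat_x, Matrix.add_mul, Matrix.one_mul, Matrix.smul_mul, Matrix.add_apply,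
    Matrix.smul_apply, Matrix.mul_apply]
  simp [he, hv.1]

/-! ### One block of `Θ`. -/

/-- The sequence `d` with the value `1` at `0`. -/
noncomputable def extendOne (d : ℕ → ℂˣ) (i : ℕ) : ℂ := if i = 0 then 1 else d i

@[simp] theorem extendOne_zero (d : ℕ → ℂˣ) : extendOne d 0 = 1 := rfl

@[simp] theorem extendOne_succ (d : ℕ → ℂˣ) (i : ℕ) : extendOne d (i + 1) = d (i + 1) := rfl

/-- The weighted partial sums `∑_{a ≤ b} Q_a / d_a`. -/
noncomputable def weightedSum (d : ℕ → ℂˣ) (Q : ℕ → ℂ) (b : ℕ) : ℂ :=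
  ∑ a ∈ Finset.range (b + 1), (extendOne d a)⁻¹ * Q a

theorem weightedSum_zero (d : ℕ → ℂˣ) (Q : ℕ → ℂ) : weightedSum d Q 0 = Q 0 := by
  simp [weightedSum]

theorem weightedSum_succ (d : ℕ → ℂˣ) (Q : ℕ → ℂ) (b : ℕ) :
    weightedSum d Q (b + 1) = (d (b + 1) : ℂ)⁻¹ * Q (b + 1) + weightedSum d Q b := by
  rw [weightedSum, Finset.sum_range_succ, add_comm]
  simp [weightedSum]

/-- The product `𝐲_1(d_1) ⋯ 𝐲_i(d_i)`. -/
noncomputable def yBoldProd (n : ℕ) (d : ℕ → ℂˣ) (i : ℕ) : G n :=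
  ((List.range' 1 i).map fun i => yBold n i (d i)).prod

theorem yBoldProd_succ (n : ℕ) (d : ℕ → ℂˣ) (i : ℕ) :
    yBoldProd n d (i + 1) = yBoldProd n d i * yBold n (i + 1) (d (i + 1)) := by
  simp [yBoldProd, List.range'_1_concat, add_comm 1 i]

/-- The factor `𝐲_{i+1}` mixes only the coordinates `i` and `i + 1`. After `i` factors those below
`i` are final, those above are untouched, and coordinate `i` is the carry handed to the next factor.
-/
theorem rowVec_vecMul_yBoldProd {n : ℕ} (d : ℕ → ℂˣ) (P Q : ℕ → ℂ) (i : ℕ) (hi : i < n) :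
    rowVec n P Q ᵥ* mat (yBoldProd n d i) =
      rowVec n
        (fun b => if b < i then P (b + 1) + extendOne d b / d (b + 1) * P b else
          if b = i then extendOne d i * P i else P b)
        (fun b => if b < i then d (b + 1) * weightedSum d Q b else
          if b = i then weightedSum d Q i else Q b) := by
  induction i with
  | zero =>
    simp only [yBoldProd, List.range'_zero, List.map_nil, List.prod_nil, mat_one, vecMul_one]
    refine rowVec_congr (fun b _ => ?_) (fun b _ => ?_) <;> by_cases h : b = 0 <;>
      simp [h, weightedSum_zero]
  | succ i ih =>
    rw [yBoldProd_succ, mat_mul, ← vecMul_vecMul, ih (by omega), rowVec_vecMul_yBold hi]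
    refine rowVec_congr (fun b _ => ?_) (fun b _ => ?_)
    all_goals
      rcases lt_trichotomy b i with h | h | h
      · simp [h, h.ne, show b < i + 1 by omega, show b ≠ i + 1 by omega]
      · subst h
        simp
        try ring
      · by_cases h' : b = i + 1
        · subst h'; simp [weightedSum_succ]
        · simp [h', h.ne', show ¬ b < i by omega, show ¬ b < i + 1 by omega]

theorem rowVec_vecMul_yBoldProd_self (m : ℕ) (d : ℕ → ℂˣ) (P Q : ℕ → ℂ) :
    rowVec (m + 1) P Q ᵥ* mat (yBoldProd (m + 1) d (m + 1)) =
      rowVec (m + 1)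
        (fun b => if b < m then P (b + 1) + extendOne d b / d (b + 1) * P b else
          extendOne d m / d (m + 1) * P m + weightedSum d Q m)
        (fun b => d (b + 1) * weightedSum d Q b) := by
  rw [yBoldProd_succ, mat_mul, ← vecMul_vecMul, rowVec_vecMul_yBoldProd d P Q m (by omega),
    rowVec_vecMul_yBold_last]
  refine rowVec_congr (fun b _ => ?_) (fun b _ => ?_)
  all_goals
    rcases Nat.lt_or_ge b m with h | h
    · simp [h, h.ne]
    · obtain rfl : b = m := by omega
      simp
      try ring

/-! ### Powers of the Coxeter element and `\bar w₀`. -/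

/-- The representative of the Coxeter element `s_1 ⋯ s_i`. -/
noncomputable def sBarProd (n i : ℕ) : G n := ((List.range' 1 i).map (sBar n)).prod

theorem sBarProd_succ (n i : ℕ) : sBarProd n (i + 1) = sBarProd n i * sBar n (i + 1) := by
  simp [sBarProd, List.range'_1_concat, add_comm 1 i]

theorem rowVec_vecMul_sBarProd {n : ℕ} (P Q : ℕ → ℂ) (i : ℕ) (hi : i < n) :
    rowVec n P Q ᵥ* mat (sBarProd n i) =
      rowVec n (fun b => if b < i then P (b + 1) else if b = i then (-1) ^ i * P 0 else P b)
        (fun b => if b < i then -Q (b + 1) else if b = i then Q 0 else Q b) := by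
  induction i with
  | zero =>
    simp only [sBarProd, List.range'_zero, List.map_nil, List.prod_nil, mat_one, vecMul_one]
    refine rowVec_congr (fun b _ => ?_) (fun b _ => ?_) <;> by_cases h : b = 0 <;> simp [h]
  | succ i ih =>
    rw [sBarProd_succ, mat_mul, ← vecMul_vecMul, ih (by omega), rowVec_vecMul_sBar hi]
    refine rowVec_congr (fun b _ => ?_) (fun b _ => ?_)
    all_goals
      rcases lt_trichotomy b i with h | h | h
      · simp [h, h.ne, show b < i + 1 by omega, show b ≠ i + 1 by omega]
      · subst h
        simp
      · by_cases h' : b = i + 1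
        · subst h'; simp [pow_succ]
        · simp [h', h.ne', show ¬ b < i by omega, show ¬ b < i + 1 by omega]

theorem rowVec_vecMul_sBarProd_self (m : ℕ) (P Q : ℕ → ℂ) :
    rowVec (m + 1) P Q ᵥ* mat (sBarProd (m + 1) (m + 1)) =
      rowVec (m + 1) (fun b => if b < m then P (b + 1) else Q 0)
        (fun b => if b < m then -Q (b + 1) else (-1) ^ (m + 1) * P 0) := by
  rw [sBarProd_succ, mat_mul, ← vecMul_vecMul, rowVec_vecMul_sBarProd P Q m (by omega),
    rowVec_vecMul_sBar_last]
  refine rowVec_congr (fun b _ => ?_) (fun b _ => ?_)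
  all_goals
    rcases Nat.lt_or_ge b m with h | h
    · simp [h, h.ne]
    · obtain rfl : b = m := by omega
      simp [pow_succ]

/-- The coordinate row vector of `v_{k+1}`. -/
noncomputable def coordV (n k : ℕ) : Idx n → ℂ := rowVec n (Pi.single k 1) 0

/-- The coordinate row vector of `v_{\overline{k+1}}`. -/
noncomputable def coordVBar (n k : ℕ) : Idx n → ℂ := rowVec n 0 (Pi.single k 1)

theorem coordVBar_vecMul_sBarProd_pow {m k t : ℕ} (h : k + t ≤ m) :
    coordVBar (m + 1) (k + t) ᵥ* mat (sBarProd (m + 1) (m + 1) ^ t) =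
      (-1 : ℂ) ^ t • coordVBar (m + 1) k := by
  induction t with
  | zero => simp [mat_one]
  | succ t ih =>
    have h1 : coordVBar (m + 1) (k + (t + 1)) ᵥ* mat (sBarProd (m + 1) (m + 1)) =
        (-1 : ℂ) • coordVBar (m + 1) (k + t) := by
      rw [coordVBar, coordVBar, rowVec_vecMul_sBarProd_self, rowVec_smul]
      refine rowVec_congr (fun b _ => ?_) (fun b hb => ?_)
      · simp
      · rcases Nat.lt_or_ge b m with h' | h'
        · by_cases hbk : b = k + t
          · simp [hbk, show k + t < m by omega, add_assoc]
          · simp [hbk, h', show b + 1 ≠ k + (t + 1) by omega]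
        · simp [show ¬ b < m by omega, show b ≠ k + t by omega]
    rw [pow_succ', mat_mul, ← vecMul_vecMul, h1, smul_vecMul, ih (by omega), smul_smul, pow_succ']

theorem coordV_vecMul_sBarProd_pow {m k t : ℕ} (h : k + t ≤ m) :
    coordV (m + 1) (k + t) ᵥ* mat (sBarProd (m + 1) (m + 1) ^ t) = coordV (m + 1) k := by
  induction t with
  | zero => simp [mat_one]
  | succ t ih =>
    have h1 : coordV (m + 1) (k + (t + 1)) ᵥ* mat (sBarProd (m + 1) (m + 1)) =
        coordV (m + 1) (k + t) := by
      rw [coordV, coordV, rowVec_vecMul_sBarProd_self]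
      refine rowVec_congr (fun b hb => ?_) (fun b hb => ?_)
      · rcases Nat.lt_or_ge b m with h' | h'
        · simp [Pi.single_apply, h', show b + 1 = k + (t + 1) ↔ b = k + t by omega]
        · simp [show ¬ b < m by omega, show b ≠ k + t by omega]
      · simp
    rw [pow_succ', mat_mul, ← vecMul_vecMul, h1, ih (by omega)]

theorem coordVBar_zero_vecMul_sBarProd (m : ℕ) :
    coordVBar (m + 1) 0 ᵥ* mat (sBarProd (m + 1) (m + 1)) = coordV (m + 1) m := by
  rw [coordV, coordVBar, rowVec_vecMul_sBarProd_self]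
  refine rowVec_congr (fun b hb => ?_) (fun b hb => ?_)
  · rcases Nat.lt_or_ge b m with h' | h'
    · simp [h', h'.ne]
    · simp [show b = m by omega]
  · simp

theorem wBar_longWord (n : ℕ) : wBar n (longWord n) = sBarProd n n ^ n := by
  simp [wBar, longWord, sBarProd, List.map_flatten, List.prod_flatten]

theorem coordVBar_vecMul_wBar {m k : ℕ} (h : k ≤ m) :
    coordVBar (m + 1) k ᵥ* mat (wBar (m + 1) (longWord (m + 1))) =
      (-1 : ℂ) ^ k • coordV (m + 1) k := by
  -- Under the Coxeter element the row takes `k` steps down to `v_{\bar 1}`, one step to `v_n`, and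
  -- `m - k` steps down to `v_{k+1}`; each step among the barred vectors costs a sign.
  have hp : wBar (m + 1) (longWord (m + 1)) = sBarProd (m + 1) (m + 1) ^ k *
      (sBarProd (m + 1) (m + 1) * sBarProd (m + 1) (m + 1) ^ (m - k)) := by
    rw [wBar_longWord, ← pow_succ', ← pow_add]
    congr 1
    omega
  have h1 := coordVBar_vecMul_sBarProd_pow (m := m) (k := 0) (t := k) (by omega)
  have h2 := coordV_vecMul_sBarProd_pow (m := m) (k := k) (t := m - k) (by omega)
  rw [zero_add] at h1
  rw [show k + (m - k) = m by omega] at h2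
  rw [hp, mat_mul, mat_mul, ← vecMul_vecMul, ← vecMul_vecMul, h1, smul_vecMul, smul_vecMul,
    coordVBar_zero_vecMul_sBarProd, h2]

theorem coordV_vecMul_inv_wBar {m k : ℕ} (h : k ≤ m) :
    coordV (m + 1) k ᵥ* mat (wBar (m + 1) (longWord (m + 1)))⁻¹ =
      (-1 : ℂ) ^ k • coordVBar (m + 1) k := by
  have h1 : coordV (m + 1) k =
      ((-1 : ℂ) ^ k • coordVBar (m + 1) k) ᵥ* mat (wBar (m + 1) (longWord (m + 1))) := by
    rw [smul_vecMul, coordVBar_vecMul_wBar h, smul_smul, ← mul_pow]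
    simp
  rw [h1, vecMul_vecMul, mat_mul_mat_inv, vecMul_one]

/-! ### Rows of `Θ` in terms of the rows of `v`. -/

/-- The product of the blocks of `Θ^-_{𝐢₀}(c)` with upper index greater than `j`. -/
noncomputable def blockProd (n : ℕ) (c : ℕ → ℕ → ℂˣ) (j : ℕ) : G n :=
  ((List.range' (j + 1) (n - j)).map fun j => yBoldProd n (fun i => c i j) n).prod

theorem blockProd_self (n : ℕ) (c : ℕ → ℕ → ℂˣ) : blockProd n c n = 1 := by
  simp [blockProd]

theorem blockProd_eq_mul {n j : ℕ} (hj : j < n) (c : ℕ → ℕ → ℂˣ) :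
    blockProd n c j = yBoldProd n (fun i => c i (j + 1)) n * blockProd n c (j + 1) := by
  rw [blockProd, show n - j = (n - (j + 1)) + 1 by omega, List.range'_succ, List.map_cons,
    List.prod_cons]
  rfl

theorem zipWith_flatten_replicate {α β γ δ : Type*} (g : α → β → γ) (h : δ → α → β) (L : List α)
    (l : List δ) :
    List.zipWith g (List.replicate l.length L).flatten (l.flatMap fun j => L.map (h j)) =
      l.flatMap fun j => L.map fun i => g i (h j i) := by
  induction l with
  | nil => simp
  | cons j l ih =>
    rw [List.length_cons, List.replicate_succ, List.flatten_cons, List.flatMap_cons,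
      List.zipWith_append (by simp), ih, List.flatMap_cons]
    rw [List.zipWith_map_right, List.zipWith_self]

theorem Theta_longWord (n : ℕ) (c : ℕ → ℕ → ℂˣ) :
    Theta n (longWord n) (params n c) = blockProd n c 0 := by
  have h := zipWith_flatten_replicate (yBold n) (fun j i => c i j) (List.range' 1 n)
    (List.range' 1 n)
  rw [List.length_range'] at h
  rw [Theta, longWord, params, h, List.flatMap_def, List.prod_flatten, List.map_map]
  rfl

/-- The row of `v_{\bar 1}` in the block `𝐲_1(d_1) ⋯ 𝐲_n(d_n)`. -/
noncomputable def blockRow (m : ℕ) (d : ℕ → ℂˣ) : Idx (m + 1) → ℂ :=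
  rowVec (m + 1) (Pi.single m 1) (fun b => d (b + 1))

theorem weightedSum_single (d : ℕ → ℂˣ) (k b : ℕ) :
    weightedSum d (Pi.single k 1) b = if k ≤ b then (extendOne d k)⁻¹ else 0 := by
  simp [weightedSum, Pi.single_apply]

theorem sum_smul_rowVec (n : ℕ) (s : Finset ℕ) (g : ℕ → ℂ) (P Q : ℕ → ℕ → ℂ) :
    ∑ a ∈ s, g a • rowVec n (P a) (Q a) =
      rowVec n (fun b => ∑ a ∈ s, g a * P a b) (fun b => ∑ a ∈ s, g a * Q a b) := by
  funext b
  rcases b with b | b <;> simp [Finset.sum_apply]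

/-- The weighted sums of a coordinate vector at `k` are `0` before `k` and `1/d_k` from `k` on, so
this row is `blockRow` truncated to barred coordinates `≥ k` and divided by `d_k`. -/
theorem coordVBar_vecMul_yBoldProd {m k : ℕ} (hk : k ≤ m) (d : ℕ → ℂˣ) :
    coordVBar (m + 1) k ᵥ* mat (yBoldProd (m + 1) d (m + 1)) =
      (extendOne d k)⁻¹ • (blockRow m d -
        ∑ a ∈ Finset.range k, (d (a + 1) : ℂ) • coordVBar (m + 1) a) := by
  simp only [coordVBar]
  rw [rowVec_vecMul_yBoldProd_self, sum_smul_rowVec, blockRow, sub_eq_add_neg,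
    ← neg_one_smul ℂ (rowVec _ _ _), rowVec_smul, rowVec_add, rowVec_smul]
  refine rowVec_congr (fun b hb => ?_) (fun b hb => ?_)
  · rcases Nat.lt_or_ge b m with h | h
    · simp [h, h.ne]
    · obtain rfl : b = m := by omega
      simp [weightedSum_single, hk]
  · simp only [weightedSum_single, Pi.smul_apply, Pi.add_apply, smul_eq_mul]
    rcases Nat.lt_or_ge b k with h | h
    · simp [Pi.single_apply, h, show ¬ k ≤ b by omega]
    · simp [Pi.single_apply, h, show ¬ b < k by omega, mul_comm]

/-- The rows of the `U⁺`-part of `\bar w₀⁻¹ Θ^-_{𝐢₀}(c)`. -/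
noncomputable def uPlusRow (m : ℕ) (c : ℕ → ℕ → ℂˣ) (j : ℕ) : Idx (m + 1) → ℂ :=
  blockRow m (fun i => c i (j + 1)) ᵥ* mat (blockProd (m + 1) c (j + 1))

/-- Peeling off one block leaves `uPlusRow m c j` and rows with smaller `k` in the remaining
product. The one with `k - 1` has coefficient `-d_k / d_k = -1`, which accounts for the alternating
sign and for the leading coefficient `1`. -/
theorem coordVBar_vecMul_blockProd_sub_mem {m : ℕ} (c : ℕ → ℕ → ℂˣ) (k : ℕ) :
    ∀ j, j + k ≤ m → (-1 : ℂ) ^ k • (coordVBar (m + 1) k ᵥ* mat (blockProd (m + 1) c j)) -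
      uPlusRow m c (j + k) ∈ Submodule.span ℂ (uPlusRow m c '' Set.Ico j (j + k)) := by
  induction k using Nat.strong_induction_on with
  | _ k ih =>
  intro j hjk
  rw [blockProd_eq_mul (by omega), mat_mul, ← vecMul_vecMul,
    coordVBar_vecMul_yBoldProd (by omega), smul_vecMul, sub_vecMul, ← uPlusRow, sum_vecMul]
  simp only [smul_vecMul]
  rcases k with _ | k
  · simp
  have hself : ∀ a ≤ k, coordVBar (m + 1) a ᵥ* mat (blockProd (m + 1) c (j + 1)) ∈
      Submodule.span ℂ (uPlusRow m c '' Set.Ico j (j + a + 2)) := by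
    intro a ha
    have h1 := Submodule.span_mono (Set.image_mono
      (Set.Ico_subset_Ico (show j ≤ j + 1 by omega) (show j + 1 + a ≤ j + a + 2 by omega)))
      (ih a (by omega) (j + 1) (by omega))
    have h2 : uPlusRow m c (j + 1 + a) ∈
        Submodule.span ℂ (uPlusRow m c '' Set.Ico j (j + a + 2)) :=
      Submodule.subset_span ⟨_, ⟨by omega, by omega⟩, rfl⟩
    have h3 := Submodule.smul_mem _ ((-1 : ℂ) ^ a) (Submodule.add_mem _ h1 h2)
    rwa [sub_add_cancel, smul_smul, ← mul_pow, neg_one_mul, neg_neg, one_pow, one_smul] at h3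
  have hlast := Submodule.span_mono (Set.image_mono
    (Set.Ico_subset_Ico (show j ≤ j + 1 by omega) (show j + 1 + k ≤ j + (k + 1) by omega)))
    (ih k (by omega) (j + 1) (by omega))
  have hq : uPlusRow m c j ∈ Submodule.span ℂ (uPlusRow m c '' Set.Ico j (j + (k + 1))) :=
    Submodule.subset_span ⟨_, ⟨le_rfl, by omega⟩, rfl⟩
  have hsum : ∑ a ∈ Finset.range k, (c (a + 1) (j + 1) : ℂ) •
      (coordVBar (m + 1) a ᵥ* mat (blockProd (m + 1) c (j + 1))) ∈
        Submodule.span ℂ (uPlusRow m c '' Set.Ico j (j + (k + 1))) := by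
    refine Submodule.sum_mem _ fun a ha => Submodule.smul_mem _ _ ?_
    have ha' := Finset.mem_range.mp ha
    exact Submodule.span_mono (Set.image_mono
      (Set.Ico_subset_Ico le_rfl (by omega))) (hself a (by omega))
  rw [Finset.sum_range_succ, extendOne_succ]
  have hd : (c (k + 1) (j + 1) : ℂ) ≠ 0 := Units.ne_zero _
  set X := coordVBar (m + 1) k ᵥ* mat (blockProd (m + 1) c (j + 1)) with hX
  set Y := ∑ a ∈ Finset.range k, (c (a + 1) (j + 1) : ℂ) •
      (coordVBar (m + 1) a ᵥ* mat (blockProd (m + 1) c (j + 1))) with hY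
  have heq : (-1 : ℂ) ^ (k + 1) • (c (k + 1) (j + 1) : ℂ)⁻¹ • (uPlusRow m c j -
      (Y + (c (k + 1) (j + 1) : ℂ) • X)) - uPlusRow m c (j + (k + 1)) =
      ((-1 : ℂ) ^ k • X - uPlusRow m c (j + 1 + k)) +
        ((-1 : ℂ) ^ (k + 1) * (c (k + 1) (j + 1) : ℂ)⁻¹) • (uPlusRow m c j - Y) := by
    rw [show j + 1 + k = j + (k + 1) by omega]
    funext b
    simp only [Pi.sub_apply, Pi.smul_apply, Pi.add_apply, smul_eq_mul, pow_succ]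
    field_simp
    ring
  rw [heq]
  exact Submodule.add_mem _ hlast (Submodule.smul_mem _ _ (Submodule.sub_mem _ hq hsum))

/-! ### Leading coordinates of the rows of `v`. -/

/-- Below `m` a block acts by `P_b ↦ P_{b+1} + (d_b / d_{b+1}) P_b`: the leading `1` moves left and
its right neighbour gains one ratio. The barred coordinates never reach these positions. -/
theorem rowVec_vecMul_blockProd {m j t : ℕ} (c : ℕ → ℕ → ℂˣ) (hjt : j + t < m) (P Q : ℕ → ℂ)
    (h0 : ∀ b < j + t, P b = 0) (h1 : P (j + t) = 1) :
    ∃ P' Q', rowVec (m + 1) P Q ᵥ* mat (blockProd (m + 1) c (m + 1 - t)) = rowVec (m + 1) P' Q' ∧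
      (∀ b < j, P' b = 0) ∧ P' j = 1 ∧
      P' (j + 1) = P (j + t + 1) + ∑ i ∈ Finset.range t,
        (c (j + i + 1) (m + 1 - i) : ℂ) / c (j + i + 2) (m + 1 - i) := by
  induction t generalizing P Q with
  | zero =>
    refine ⟨P, Q, ?_, h0, h1, by simp⟩
    rw [Nat.sub_zero, blockProd_self, mat_one, vecMul_one]
  | succ t ih =>
    rw [blockProd_eq_mul (by omega), mat_mul, ← vecMul_vecMul, rowVec_vecMul_yBoldProd_self,
      show m + 1 - (t + 1) + 1 = m + 1 - t by omega]
    obtain ⟨P', Q', h, hz, ho, hn⟩ := ih (by omega) (fun b =>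
      (c (b + 1) (m + 1 - t) : ℂ) * weightedSum (fun i => c i (m + 1 - t)) Q b)
      (P := fun b => if b < m then P (b + 1) +
        extendOne (fun i => c i (m + 1 - t)) b / c (b + 1) (m + 1 - t) * P b else
        extendOne (fun i => c i (m + 1 - t)) m / c (m + 1) (m + 1 - t) * P m +
          weightedSum (fun i => c i (m + 1 - t)) Q m)
      (fun b hb => by simp [show b < m by omega, h0 (b + 1) (by omega), h0 b (by omega)])
      (by simp [show j + t < m by omega, h0 (j + t) (by omega),
        show P (j + t + 1) = 1 from h1])
    refine ⟨P', Q', h, hz, ho, ?_⟩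
    rw [hn, Finset.sum_range_succ, if_pos (by omega), show P (j + t + 1) = 1 from h1,
      extendOne_succ]
    simp only [show j + (t + 1) + 1 = j + t + 1 + 1 by omega]
    ring

theorem uPlusRow_eq {m j : ℕ} (c : ℕ → ℕ → ℂˣ) (hj : j < m) :
    ∃ P Q, uPlusRow m c j = rowVec (m + 1) P Q ∧ (∀ b < j, P b = 0) ∧ P j = 1 ∧
      P (j + 1) = weightedSum (fun i => c i (j + 2)) (fun b => c (b + 1) (j + 1)) m +
        ∑ i ∈ Finset.range (m - j),
          (c (j + i + 1) (m + 1 - i) : ℂ) / c (j + i + 2) (m + 1 - i) := by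
  -- Of the `m - j` remaining blocks the first is treated apart: there the leading `1` sits at `m`,
  -- the only place where the barred coordinates enter, through `weightedSum`.
  obtain ⟨t, rfl⟩ : ∃ t, m = j + t + 1 := ⟨m - j - 1, by omega⟩
  rw [uPlusRow, blockProd_eq_mul (by omega), mat_mul, ← vecMul_vecMul, blockRow,
    rowVec_vecMul_yBoldProd_self, show j + 1 + 1 = j + t + 1 + 1 - t by omega]
  obtain ⟨P', Q', h, hz, ho, hn⟩ := rowVec_vecMul_blockProd (j := j) (t := t) c
    (show j + t < j + t + 1 by omega) (fun b =>
      (c (b + 1) (j + t + 1 + 1 - t) : ℂ) *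
        weightedSum (fun i => c i (j + t + 1 + 1 - t)) (fun b => c (b + 1) (j + 1)) b)
    (P := fun b => if b < j + t + 1 then (Pi.single (j + t + 1) 1 : ℕ → ℂ) (b + 1) +
        extendOne (fun i => c i (j + t + 1 + 1 - t)) b / c (b + 1) (j + t + 1 + 1 - t) *
          (Pi.single (j + t + 1) 1 : ℕ → ℂ) b else
        extendOne (fun i => c i (j + t + 1 + 1 - t)) (j + t + 1) /
          c (j + t + 1 + 1) (j + t + 1 + 1 - t) * (Pi.single (j + t + 1) 1 : ℕ → ℂ) (j + t + 1) +
          weightedSum (fun i => c i (j + t + 1 + 1 - t)) (fun b => c (b + 1) (j + 1)) (j + t + 1))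
    (fun b hb => by
      simp [show b < j + t + 1 by omega, show b ≠ j + t by omega, show b ≠ j + t + 1 by omega])
    (by simp)
  refine ⟨P', Q', h, hz, ho, ?_⟩
  rw [hn, if_neg (by omega), Pi.single_eq_same, extendOne_succ,
    show j + t + 1 - j = t + 1 by omega, Finset.sum_range_succ,
    show j + t + 1 + 1 - t = j + 2 by omega]
  ring

theorem uPlusRow_last (m : ℕ) (c : ℕ → ℕ → ℂˣ) :
    uPlusRow m c m = rowVec (m + 1) (Pi.single m 1) (fun b => c (b + 1) (m + 1)) := by
  rw [uPlusRow, blockProd_self, mat_one, vecMul_one, blockRow]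

theorem uPlusRow_unitriangular {m : ℕ} (c : ℕ → ℕ → ℂˣ) (j : Fin (m + 1)) :
    uPlusRow m c j (Sum.inl j) = 1 ∧ ∀ b < j, uPlusRow m c j (Sum.inl b) = 0 := by
  rcases Nat.lt_or_ge j.val m with hj | hj
  · obtain ⟨P, Q, h, hz, ho, -⟩ := uPlusRow_eq c hj
    rw [h]
    exact ⟨ho, fun b hb => hz _ hb⟩
  · have hjm : j.val = m := by omega
    rw [hjm, uPlusRow_last]
    refine ⟨by simp [hjm], fun b hb => ?_⟩
    rw [Fin.lt_def] at hb
    simp [show b.val ≠ m by omega]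

/-! ### The decomposition of `\bar w₀⁻¹ Θ` and the final sums. -/

theorem exists_lower_unitriangular (m : ℕ) (c : ℕ → ℕ → ℂˣ) (k : Fin (m + 1)) :
    ∃ l : Fin (m + 1) → ℂ, l k = 1 ∧ (∀ j, k < j → l j = 0) ∧
      (-1 : ℂ) ^ k.val • (coordVBar (m + 1) k ᵥ* mat (blockProd (m + 1) c 0)) =
        ∑ j, l j • uPlusRow m c j := by
  have h := coordVBar_vecMul_blockProd_sub_mem c k.val 0 (m := m) (by omega)
  have himg : uPlusRow m c '' Set.Ico 0 (0 + k.val) =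
      (fun j : Fin (m + 1) => uPlusRow m c j) '' Set.Iio k := by
    ext ξ
    constructor
    · rintro ⟨j, hj, rfl⟩
      have hj' := hj.2
      exact ⟨⟨j, by omega⟩, by rw [Set.mem_Iio, Fin.lt_def]; simpa using hj', rfl⟩
    · rintro ⟨j, hj, rfl⟩
      exact ⟨j.val, ⟨by omega, by simpa using hj⟩, rfl⟩
  rw [himg, zero_add, ← Finset.coe_Iio, Submodule.mem_span_image_finset_iff_exists_fun'] at h
  obtain ⟨a, ha⟩ := h
  refine ⟨fun j => (if j < k then a j else 0) + if j = k then 1 else 0, by simp,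
    fun j hj => by simp [hj.not_gt, hj.ne'], ?_⟩
  simp only [add_smul, Finset.sum_add_distrib, ite_smul, zero_smul, one_smul,
    Finset.sum_ite_eq', Finset.mem_univ, if_true]
  rw [← Finset.sum_filter, Finset.filter_gt_eq_Iio, ha, sub_add_cancel]

theorem coordV_eq_single {n : ℕ} (k : Fin n) : coordV n k = Pi.single (Sum.inl k) 1 := by
  funext b
  rcases b with b | b <;> simp [coordV, Pi.single_apply, Fin.ext_iff]

theorem inv_wBar_mul_Theta_apply {m : ℕ} (c : ℕ → ℕ → ℂˣ) (k : Fin (m + 1)) (b : Idx (m + 1)) :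
    mat ((wBar (m + 1) (longWord (m + 1)))⁻¹ *
      Theta (m + 1) (longWord (m + 1)) (params (m + 1) c)) (Sum.inl k) b =
      ((-1 : ℂ) ^ k.val • (coordVBar (m + 1) k ᵥ* mat (blockProd (m + 1) c 0))) b := by
  rw [← smul_vecMul, ← coordV_vecMul_inv_wBar (show k.val ≤ m by omega), vecMul_vecMul,
    coordV_eq_single, ← Theta_longWord, ← mat_mul]
  simp

/-- The decomposition of `\bar w₀⁻¹ Θ^-_{𝐢₀}(c)` in `U⁻ U⁺`. -/
theorem exists_inv_wBar_mul_Theta_eq (m : ℕ) (c : ℕ → ℕ → ℂˣ) :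
    ∃ u v : G (m + 1), IsUMinus u ∧ IsUPlus v ∧
      (wBar (m + 1) (longWord (m + 1)))⁻¹ *
        Theta (m + 1) (longWord (m + 1)) (params (m + 1) c) = u * v ∧
      ∀ (k : Fin (m + 1)) (b : Idx (m + 1)), mat v (Sum.inl k) b = uPlusRow m c k b := by
  choose l hl1 hl hrow using exists_lower_unitriangular m c
  have hentry : ∀ (k : Fin (m + 1)) (b : Idx (m + 1)),
      mat ((wBar (m + 1) (longWord (m + 1)))⁻¹ *
        Theta (m + 1) (longWord (m + 1)) (params (m + 1) c)) (Sum.inl k) b =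
        ∑ j, l k j * uPlusRow m c j b := by
    intro k b
    rw [inv_wBar_mul_Theta_apply, hrow, Finset.sum_apply]
    rfl
  obtain ⟨u, v, hu, hv, hg, h1, h2⟩ := exists_uMinus_mul_uPlus
    ((wBar (m + 1) (longWord (m + 1)))⁻¹ * Theta (m + 1) (longWord (m + 1)) (params (m + 1) c))
    (Matrix.of l) (Matrix.of fun j b => uPlusRow m c j (Sum.inl b))
    (Matrix.of fun j b => uPlusRow m c j (Sum.inr b)) hl1 hl
    (fun j => (uPlusRow_unitriangular c j).1) (fun j b hb => (uPlusRow_unitriangular c j).2 b hb)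
    (by ext k b; exact hentry k (Sum.inl b)) (by ext k b; exact hentry k (Sum.inr b))
  refine ⟨u, v, hu, hv, hg, ?_⟩
  rintro k (b | b)
  · exact congrFun (congrFun h1 k) b
  · exact congrFun (congrFun h2 k) b

theorem principalMinor_spec (n k : ℕ) :
    IsPrincipalMinor (fundWeight n k) (principalMinor n k) :=
  (exists_principalMinor n k).choose_spec

theorem wBar_singleton (n k : ℕ) : wBar n [k] = sBar n k := by simp [wBar]

/-- The summand at `0` has denominator `1` by the convention of `extendOne`, hence the isolated
first term. -/
theorem weightedSum_eq (m : ℕ) (d d' : ℕ → ℂˣ) :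
    weightedSum d (fun b => d' (b + 1)) m =
      (d' 1 : ℂ) + ∑ j ∈ Finset.Icc 2 (m + 1), (d' j : ℂ) / d (j - 1) := by
  induction m with
  | zero => simp [weightedSum_zero]
  | succ m ih =>
    rw [weightedSum_succ, ih, Finset.sum_Icc_succ_top (show 2 ≤ m + 1 + 1 by omega),
      Nat.add_sub_cancel]
    ring

theorem sum_range_eq_sum_Icc {m j : ℕ} (hj : j < m) (c : ℕ → ℕ → ℂˣ) :
    ∑ i ∈ Finset.range (m - j), (c (j + i + 1) (m + 1 - i) : ℂ) / c (j + i + 2) (m + 1 - i) =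
      ∑ i ∈ Finset.Icc 1 (m + 1 - (j + 1)),
        (c (m + 1 - i) (j + 1 + i) : ℂ) / c (m + 1 - i + 1) (j + 1 + i) := by
  refine Finset.sum_nbij' (fun i => m - j - i) (fun i => m - j - i) ?_ ?_ ?_ ?_ ?_
  all_goals
    intro i hi
    simp only [Finset.mem_range, Finset.mem_Icc] at hi ⊢
  · omega
  · omega
  · omega
  · omega
  · rw [show m + 1 - (m - j - i) = j + i + 1 by omega, show j + 1 + (m - j - i) = m + 1 - i by omega]

end TypeC

theorem mainTheorem1 (n : ℕ) (c : ℕ → ℕ → ℂˣ) :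
    (∀ k : ℕ, 1 ≤ k → k < n →
      TypeC.genMinor n k (TypeC.longWord n) [k]
          (TypeC.Theta n (TypeC.longWord n) (TypeC.params n c)) =
        (c 1 k : ℂ)
          + ∑ j ∈ Finset.Icc 2 n, (c j k : ℂ) / (c (j - 1) (k + 1) : ℂ)
          + ∑ j ∈ Finset.Icc 1 (n - k), (c (n - j) (k + j) : ℂ) / (c (n - j + 1) (k + j) : ℂ)) ∧
    (1 ≤ n →
      TypeC.genMinor n n (TypeC.longWord n) [n]
          (TypeC.Theta n (TypeC.longWord n) (TypeC.params n c)) = (c n n : ℂ)) := by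
  rcases n with _ | m
  · exact ⟨fun k _ hk => absurd hk (by omega), fun h => absurd h (by omega)⟩
  obtain ⟨u, v, hu, hv, hg, hrow⟩ := TypeC.exists_inv_wBar_mul_Theta_eq m c
  refine ⟨fun k hk hkn => ?_, fun _ => ?_⟩
  · obtain ⟨j, rfl⟩ : ∃ j, k = j + 1 := ⟨k - 1, by omega⟩
    obtain ⟨P, Q, hPQ, -, -, hP⟩ := TypeC.uPlusRow_eq c (show j < m by omega)
    rw [TypeC.genMinor, TypeC.wBar_singleton, hg,
      (TypeC.principalMinor_spec (m + 1) (j + 1)).apply_mul_mul_sBar hkn hu hv, hrow, hPQ,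
      TypeC.rowVec_inl, hP, TypeC.sum_range_eq_sum_Icc (by omega),
      TypeC.weightedSum_eq m (fun i => c i (j + 2)) (fun i => c i (j + 1))]
  -- No block follows the last one, so row `n` of `v` is `blockRow` of block `n`, with coordinate
  -- `c_n^{(n)}` at `v_{\bar n}`.
  · rw [TypeC.genMinor, TypeC.wBar_singleton, hg,
      (TypeC.principalMinor_spec (m + 1) (m + 1)).apply_mul_mul_sBar_last hu hv, hrow,
      Fin.val_last, TypeC.uPlusRow_last, TypeC.rowVec_inr, Fin.val_last]
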